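/- Let $\lambda,\mu>0$, $i\in\mathbb N\cup\{0\}$ and $\alpha\in(0,1]$. Let $N^1(t)$, $t\ge0$, be the classical M/M/1 queue with arrival rate $\lambda$, service rate $\mu$ and $N^1(0)=i$, i.e. the $\mathbb N\cup\{0\}$-valued continuous-time Markov chain with right-continuous paths that goes from $k$ to $k+1$ at rate $\lambda$ and, for $k\ge1$, from $k$ to $k-1$ at rate $\mu$. Let $V^\alpha$ be an $\alpha$-stable subordinator, normalised by $\mathbb E\,e^{-\xi V^\alpha(t)}=e^{-t\xi^\alpha}$, let $E^\alpha(t)=\inf\{s>0: V^\alpha(s)>t\}$ be its inverse, and suppose that the processes $E^\alpha$ and $N^1$ are independent. A fractional M/M/1 queue of order $\alpha$ with these parameters is an $\mathbb N\cup\{0\}$-valued process $N^\alpha(t)$, $t\ge0$, whose state probabilities $p_k^\alpha(t)=\Pr\{N^\alpha(t)=k\}$ are continuous on $[0,\infty)$ and satisfy, for all $t>0$, $$D_t^\alpha p_k^\alpha=-(\lambda+\mu)p_k^\alpha+\lambda p_{k-1}^\alpha+\mu p_{k+1}^\alpha\ (k\ge1),\qquad D_t^\alpha p_0^\alpha=-\lambda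 p_0^\alpha+\mu p_1^\alpha,\qquad p_k^\alpha(0)=\delta_{k,i}.$$ Here, for $\alpha<1$, $D_t^\alpha f(t)=\frac1{\Gamma(1-\alpha)}\int_0^t (t-y)^{-\alpha}f'(y)\,\mathrm dy$ is the Caputo derivative, for $f$ absolutely continuous on every $[0,t]$ (with the integrand integrable), and $D_t^1=\mathrm d/\mathrm dt$. Then the process $N^1(E^\alpha(t))$, $t\ge0$, is a fractional M/M/1 queue of order $\alpha$ with these parameters, and every fractional M/M/1 queue $N^\alpha$ of order $\alpha$ with these parameters satisfies $N^\alpha(t)\overset{d}{=}N^1(E^\alpha(t))$ for every $t\ge0$. -/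

import Mathlib

open MeasureTheory ProbabilityTheory Set
open scoped NNReal

noncomputable section

/-- `f` has at `t` the Caputo derivative `g` of order `α ∈ (0, 1]` with base point `0`.
For `α < 1` this means that `f` is absolutely continuous on `[0, t]`, that
`y ↦ (t - y) ^ (-α) * f' y` is integrable on `(0, t)`, and that
`g = 1 / Γ(1 - α) * ∫ y in 0..t, (t - y) ^ (-α) * f' y`.
For `α = 1` it is the ordinary derivative. -/
def HasCaputoDerivAt (α : ℝ) (f : ℝ → ℝ) (g t : ℝ) : Prop :=
  if α = 1 then HasDerivAt f g t
  else
    AbsolutelyContinuousOnInterval f 0 t ∧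
    IntervalIntegrable (fun y => (t - y) ^ (-α) * deriv f y) volume 0 t ∧
    g = 1 / Real.Gamma (1 - α) * ∫ y in (0 : ℝ)..t, (t - y) ^ (-α) * deriv f y

/-- Right-hand side of the M/M/1 difference-differential equations with arrival rate `lam` and
service rate `mu`. -/
def queueRHS (lam mu : ℝ) (p : ℕ → ℝ → ℝ) : ℕ → ℝ → ℝ
  | 0, t => -lam * p 0 t + mu * p 1 t
  | k + 1, t => -(lam + mu) * p (k + 1) t + lam * p k t + mu * p (k + 2) t

/-- The functions `p k`, `k ≥ 0`, on `[0, ∞)` solve the fractional M/M/1 system of order `α`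
started from `i` customers. For `α = 1` this is the classical M/M/1 system. -/
structure SolvesQueueSystem (α lam mu : ℝ) (i : ℕ) (p : ℕ → ℝ → ℝ) : Prop where
  continuousOn : ∀ k, ContinuousOn (p k) (Ici 0)
  equation : ∀ k t, 0 < t → HasCaputoDerivAt α (p k) (queueRHS lam mu p k t) t
  initial : ∀ k, p k 0 = if k = i then 1 else 0

/-- `N` is a fractional M/M/1 queue of order `α`: its state probabilities
`p k t = P (N t = k)` solve the fractional M/M/1 system. -/
structure IsFractionalMM1Queue {Ω : Type*} [MeasurableSpace Ω] (α lam mu : ℝ) (i : ℕ)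
    (N : ℝ≥0 → Ω → ℕ) (P : Measure Ω) : Prop where
  aemeasurable : ∀ t, AEMeasurable (N t) P
  system : SolvesQueueSystem α lam mu i (fun k t => P.real {ω | N t.toNNReal ω = k})

/-- `T j k t` is the probability of a transition from `j` to `k` in time `t` for the M/M/1
birth-death mechanism (births at rate `lam`, deaths at rate `mu` from every state `k ≥ 1`). -/
structure IsMM1Transition (lam mu : ℝ) (T : ℕ → ℕ → ℝ → ℝ) : Prop where
  nonneg : ∀ j k t, 0 ≤ t → 0 ≤ T j k t
  hasSum : ∀ j t, 0 ≤ t → HasSum (fun k => T j k t) 1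
  forward : ∀ j, SolvesQueueSystem 1 lam mu j (T j)

/-- `N` is the classical M/M/1 queue started from `i` customers: the time-homogeneous
`ℕ`-valued Markov chain in continuous time with the M/M/1 transition probabilities and (almost
surely) right-continuous paths. -/
structure IsMM1Queue {Ω : Type*} [MeasurableSpace Ω] (lam mu : ℝ) (i : ℕ)
    (N : ℝ≥0 → Ω → ℕ) (P : Measure Ω) : Prop where
  measurable : ∀ t, Measurable (N t)
  rightCont : ∀ᵐ ω ∂P, ∀ t, ContinuousWithinAt (fun s => N s ω) (Ici t) t
  markov : ∃ T : ℕ → ℕ → ℝ → ℝ, IsMM1Transition lam mu T ∧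
    ∀ (n : ℕ) (t : Fin (n + 1) → ℝ≥0) (k : Fin (n + 1) → ℕ), Monotone t →
      P.real {ω | ∀ m, N (t m) ω = k m} =
        T i (k 0) (t 0) *
          ∏ m : Fin n, T (k m.castSucc) (k m.succ) ((t m.succ : ℝ) - (t m.castSucc : ℝ))

/-- `V` is an `α`-stable subordinator: a nondecreasing Lévy process with
`E exp (-ξ V t) = exp (-t ξ ^ α)`. -/
structure IsStableSubordinator {Ω : Type*} [MeasurableSpace Ω] (α : ℝ)
    (V : ℝ≥0 → Ω → ℝ) (P : Measure Ω) : Prop where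
  measurable : ∀ t, Measurable (V t)
  zero : ∀ᵐ ω ∂P, V 0 ω = 0
  indepIncrements : HasIndepIncrements V P
  stationaryIncrements : ∀ s t, IdentDistrib (fun ω => V (s + t) ω - V s ω) (V t) P P
  monotone : ∀ᵐ ω ∂P, Monotone (fun s => V s ω)
  rightCont : ∀ᵐ ω ∂P, ∀ t, ContinuousWithinAt (fun s => V s ω) (Ici t) t
  laplace : ∀ (t : ℝ≥0) (ξ : ℝ), 0 < ξ →
    ∫ ω, Real.exp (-ξ * V t ω) ∂P = Real.exp (-(t : ℝ) * ξ ^ α)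

/-- The inverse (hitting time) process `E t = inf {s > 0 : V s > t}`. (For a stable subordinator
the set is almost surely nonempty.) -/
def inverseProcess {Ω : Type*} (V : ℝ≥0 → Ω → ℝ) (t : ℝ≥0) (ω : Ω) : ℝ≥0 :=
  sInf {s : ℝ≥0 | 0 < s ∧ (t : ℝ) < V s ω}

end

/-!
The generator of the M/M/1 queue, read as the operator `queueOp` on sequences `q : ℕ → ℝ`, is bounded
in the supremum norm by `C = 2 (lam + mu)`. Its iterates on the indicator of the initial state are
the coefficients `queueCoeff n k`, bounded by `C ^ n`, and the fractional system is solved by the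
Mittag-Leffler series `∑ n, queueCoeff n k * t ^ (α n) / Γ (α n + 1)` (`queueSolution`); for `α = 1`
this is the exponential of the generator. That it is a solution
(`solvesQueueSystem_queueSolution`) rests on the beta integral: Riemann-Liouville integration of
order `γ` sends `t ^ (β - 1) / Γ β` to `t ^ (β + γ - 1) / Γ (β + γ)`, and it may be carried out term by
term (`integral_sub_rpow_mul_mittagLefflerSeries`).

It is the only solution that is bounded on every `[0, R]`, uniformly in the state
(`SolvesQueueSystem.unique`). Indeed, Riemann-Liouville integration of order `α` turns the system
into a Volterra equation (`SolvesQueueSystem.volterra`), and iterating that equation `n` times bounds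
the difference of two solutions by a multiple of `(C t ^ α) ^ n / Γ (α n + 1)`, which tends to `0`.
State probabilities are bounded by `1`, so every fractional queue has the state probabilities
`queueSolution α`, and the classical queue has those for `α = 1`.

For the time-changed queue, independence and right-continuity give
`P (N (E t) = k) = ∫ P (N s = k) P (E t ∈ ds)` (`IndepFun.measureReal_time_change`). Inserting the
exponential series reduces the claim to the moments
`𝔼 (E t) ^ n = n! t ^ (α n) / Γ (α n + 1)` of the inverse subordinator
(`IsStableSubordinator.lintegral_inverseProcess_pow`). Since `{E t > s}` and `{V s ≤ t}` have the same
probability for almost every `s`, the layer cake formula identifies `𝔼 (E t) ^ (n + 1)` with the mass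
that the measure `∫ (n + 1) s ^ n P (V s ∈ ·) ds` gives to `(-∞, t]`. The Laplace transform of that
measure is `(n + 1)! ξ ^ (-α (n + 1))`, which determines it
(`IsStableSubordinator.bind_map_eq`, `Measure.ext_of_lintegral_exp_neg`).
-/

open Filter Topology
open scoped ENNReal

/-! ### Beta integrals -/

theorem integral_sub_rpow_mul_rpow {a b t : ℝ} (ha : 0 < a) (hb : 0 < b) (ht : 0 < t) :
    ∫ y in (0 : ℝ)..t, (t - y) ^ (a - 1) * y ^ (b - 1) =
      Real.Gamma a * Real.Gamma b / Real.Gamma (a + b) * t ^ (a + b - 1) := by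
  have h := Complex.betaIntegral_scaled (b : ℂ) (a : ℂ) ht
  rw [Complex.betaIntegral_eq_Gamma_mul_div _ _ (by simpa) (by simpa)] at h
  have h2 : ∫ x in (0 : ℝ)..t, (x : ℂ) ^ ((b : ℂ) - 1) * ((t : ℂ) - x) ^ ((a : ℂ) - 1)
      = ((∫ y in (0 : ℝ)..t, (t - y) ^ (a - 1) * y ^ (b - 1) : ℝ) : ℂ) := by
    rw [← intervalIntegral.integral_ofReal]
    refine intervalIntegral.integral_congr fun x hx => ?_
    rw [uIcc_of_le ht.le] at hx
    rw [Complex.ofReal_mul, Complex.ofReal_cpow hx.1, Complex.ofReal_cpow (sub_nonneg.2 hx.2)]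
    push_cast
    ring
  rw [h2] at h
  have h3 : ((t : ℂ) ^ ((b : ℂ) + a - 1)) = ((t ^ (a + b - 1) : ℝ) : ℂ) := by
    rw [Complex.ofReal_cpow ht.le]; push_cast; ring_nf
  rw [h3, Complex.Gamma_ofReal, Complex.Gamma_ofReal, ← Complex.ofReal_add,
    Complex.Gamma_ofReal] at h
  rw [add_comm b a] at h
  have : ∫ y in (0 : ℝ)..t, (t - y) ^ (a - 1) * y ^ (b - 1) =
      t ^ (a + b - 1) * (Real.Gamma b * Real.Gamma a / Real.Gamma (a + b)) := by
    exact_mod_cast h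
  rw [this]; ring

theorem intervalIntegrable_sub_rpow_mul_rpow {a b t : ℝ} (ha : 0 < a) (hb : 0 < b) (ht : 0 < t) :
    IntervalIntegrable (fun y => (t - y) ^ (a - 1) * y ^ (b - 1)) volume 0 t := by
  -- A non-integrable function would have integral zero, but the beta integral is positive.
  by_contra h
  have h1 := intervalIntegral.integral_undef h
  rw [integral_sub_rpow_mul_rpow ha hb ht] at h1
  have := Real.Gamma_pos_of_pos ha
  have := Real.Gamma_pos_of_pos hb
  have := Real.Gamma_pos_of_pos (add_pos ha hb)
  have h2 : 0 < Real.Gamma a * Real.Gamma b / Real.Gamma (a + b) * t ^ (a + b - 1) := by positivity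
  exact h2.ne' h1

theorem integral_sub_rpow_mul_sub_rpow {a b t z : ℝ} (ha : 0 < a) (hb : 0 < b) (hz : z < t) :
    ∫ y in z..t, (t - y) ^ (a - 1) * (y - z) ^ (b - 1) =
      Real.Gamma a * Real.Gamma b / Real.Gamma (a + b) * (t - z) ^ (a + b - 1) := by
  rw [← integral_sub_rpow_mul_rpow ha hb (sub_pos.2 hz)]
  have := intervalIntegral.integral_comp_sub_right
    (fun y => (t - z - y) ^ (a - 1) * y ^ (b - 1)) z (a := z) (b := t)
  simpa using this

theorem intervalIntegrable_sub_rpow_mul_sub_rpow {a b t z : ℝ} (ha : 0 < a) (hb : 0 < b)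
    (hz : z < t) :
    IntervalIntegrable (fun y => (t - y) ^ (a - 1) * (y - z) ^ (b - 1)) volume z t := by
  have := (intervalIntegrable_sub_rpow_mul_rpow ha hb (sub_pos.2 hz)).comp_sub_right z
  simpa using this

/-! ### Growth of the Gamma function -/

/-- Restrict Euler's integral to `(R, ∞)`, where `y ^ x ≥ R ^ x`. -/
theorem rpow_mul_exp_neg_le_Gamma_add_one {x R : ℝ} (hx : 0 < x) (hR : 0 < R) :
    R ^ x * Real.exp (-R) ≤ Real.Gamma (x + 1) := by
  rw [Real.Gamma_eq_integral (by linarith)]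
  have hint := Real.GammaIntegral_convergent (s := x + 1) (by linarith)
  have h1 : ∫ y in Ioi R, Real.exp (-y) * R ^ x ≤
      ∫ y in Ioi R, Real.exp (-y) * y ^ (x + 1 - 1) := by
    refine setIntegral_mono_on ?_ (hint.mono_set (Ioi_subset_Ioi hR.le)) measurableSet_Ioi ?_
    · exact (integrableOn_exp_neg_Ioi R).mul_const _
    · intro y hy
      have hy' : R < y := hy
      rw [add_sub_cancel_right]
      gcongr
  have h2 : ∫ y in Ioi R, Real.exp (-y) * y ^ (x + 1 - 1) ≤
      ∫ y in Ioi 0, Real.exp (-y) * y ^ (x + 1 - 1) := by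
    refine setIntegral_mono_set hint ?_ (Ioi_subset_Ioi hR.le).eventuallyLE
    refine (ae_restrict_iff' measurableSet_Ioi).2 (ae_of_all _ fun y hy => ?_)
    have hy' : 0 < y := hy
    simp only [Pi.zero_apply]
    positivity
  rw [integral_mul_const, integral_exp_neg_Ioi] at h1
  linarith

/-- The series of the two-parameter Mittag-Leffler function has infinite radius of convergence. -/
theorem summable_pow_div_Gamma {α β C : ℝ} (hα : 0 < α) (hβ : 0 < β) (hC : 0 ≤ C) :
    Summable fun n : ℕ => C ^ n / Real.Gamma (α * n + β) := by
  -- This `R` makes `R ^ α` exceed `4 C`: a factor `2 ^ n` is spent on `α n + β = O(2 ^ n)`, and a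
  -- geometric series of ratio `1 / 2` remains.
  set R : ℝ := (4 * C + 1) ^ (1 / α) with hR
  have hR0 : 0 < R := by positivity
  have hRα : R ^ α = 4 * C + 1 := by
    rw [hR, ← Real.rpow_mul (by positivity), one_div_mul_cancel hα.ne', Real.rpow_one]
  have hgeo : Summable fun n : ℕ => (α + β) * Real.exp R * (R ^ β)⁻¹ * (1 / 2 : ℝ) ^ n :=
    (summable_geometric_of_lt_one (by norm_num) (by norm_num)).mul_left _
  refine Summable.of_nonneg_of_le (fun n => ?_) (fun n => ?_) hgeo
  · have := Real.Gamma_pos_of_pos (show 0 < α * n + β by positivity)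
    positivity
  · have hx : 0 < α * n + β := by positivity
    have hG := Real.Gamma_pos_of_pos hx
    have h1 := rpow_mul_exp_neg_le_Gamma_add_one hx hR0
    rw [Real.Gamma_add_one hx.ne', Real.rpow_add hR0, Real.rpow_mul hR0.le, hRα,
      Real.rpow_natCast, Real.exp_neg] at h1
    have hn : (n : ℝ) + 1 ≤ 2 ^ n := by
      exact_mod_cast Nat.lt_two_pow_self
    have h2 : α * n + β ≤ (α + β) * 2 ^ n := by
      have : α * n + β ≤ (α + β) * (n + 1) := by nlinarith [Nat.cast_nonneg (α := ℝ) n]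
      exact this.trans (by gcongr)
    have h3 : C ^ n * 4 ^ n ≤ (4 * C + 1) ^ n := by
      rw [← mul_pow]; gcongr; linarith
    have hβR : 0 < R ^ β := by positivity
    have hE := Real.exp_pos R
    rw [div_le_iff₀ hG]
    have h4 : C ^ n * 4 ^ n * R ^ β ≤ (α + β) * 2 ^ n * Real.Gamma (α * n + β) * Real.exp R := by
      calc C ^ n * 4 ^ n * R ^ β ≤ (4 * C + 1) ^ n * R ^ β := by gcongr
        _ = (4 * C + 1) ^ n * R ^ β * (Real.exp R)⁻¹ * Real.exp R := by field_simp
        _ ≤ (α * n + β) * Real.Gamma (α * n + β) * Real.exp R := by gcongr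
        _ ≤ _ := by gcongr
    have h5 : (4 : ℝ) ^ n = 2 ^ n * 2 ^ n := by rw [← mul_pow]; norm_num
    rw [h5] at h4
    have h6 : C ^ n * 2 ^ n * R ^ β ≤ (α + β) * Real.Gamma (α * n + β) * Real.exp R := by
      have h2n : (0 : ℝ) < 2 ^ n := by positivity
      refine le_of_mul_le_mul_right ?_ h2n
      linarith
    rw [one_div, inv_pow]
    have : (α + β) * Real.exp R * (R ^ β)⁻¹ * (2 ^ n)⁻¹ * Real.Gamma (α * n + β) =
      ((α + β) * Real.Gamma (α * n + β) * Real.exp R) / (R ^ β * 2 ^ n) := by field_simp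
    rw [this, le_div_iff₀ (by positivity)]
    linarith

/-! ### Mittag-Leffler series -/

theorem integrable_tsum_of_summable_integral_norm {X : Type*} [MeasurableSpace X] {μ : Measure X}
    {F : ℕ → X → ℝ} (hm : AEStronglyMeasurable (fun x => ∑' n, F n x) μ)
    (hF : ∀ n, Integrable (F n) μ) (hsum : Summable fun n => ∫ x, ‖F n x‖ ∂μ) :
    Integrable (fun x => ∑' n, F n x) μ := by
  refine ⟨hm, ?_⟩
  have h1 : ∫⁻ x, ‖∑' n, F n x‖ₑ ∂μ ≤ ∫⁻ x, ∑' n, ‖F n x‖ₑ ∂μ :=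
    lintegral_mono fun x => enorm_tsum_le_tsum_enorm
  refine lt_of_le_of_lt h1 ?_
  rw [lintegral_tsum fun n => (hF n).1.enorm]
  have h2 : ∀ n, ∫⁻ x, ‖F n x‖ₑ ∂μ = ENNReal.ofReal (∫ x, ‖F n x‖ ∂μ) := fun n =>
    (ofReal_integral_norm_eq_lintegral_enorm (hF n)).symm
  simp_rw [h2]
  rw [← ENNReal.ofReal_tsum_of_nonneg (fun n => integral_nonneg fun _ => norm_nonneg _) hsum]
  exact ENNReal.ofReal_lt_top

/-- The generalised Mittag-Leffler series `∑ c n * t ^ (α n + β - 1) / Γ (α n + β)`. The powers are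
normalised so that the Riemann-Liouville integral of order `γ` just replaces `β` by `β + γ`. -/
noncomputable def mittagLefflerSeries (α β : ℝ) (c : ℕ → ℝ) (t : ℝ) : ℝ :=
  ∑' n : ℕ, c n * (t ^ (α * n + β - 1) / Real.Gamma (α * n + β))

section
variable {α β B C : ℝ} {c : ℕ → ℝ}

theorem abs_mul_rpow_div_Gamma_le (hα : 0 < α) (hβ : 0 < β)
    (hc : ∀ n, |c n| ≤ B * C ^ n) {t R : ℝ} (ht : 0 ≤ t) (htR : t ≤ R) (n : ℕ) :
    |c n| * (t ^ (α * n) / Real.Gamma (α * n + β)) ≤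
      B * ((C * R ^ α) ^ n / Real.Gamma (α * n + β)) := by
  have hG := Real.Gamma_pos_of_pos (show 0 < α * n + β by positivity)
  have h1 : t ^ (α * n) ≤ R ^ (α * n) := by gcongr
  have h2 : R ^ (α * n) = (R ^ α) ^ n := by
    rw [Real.rpow_mul (ht.trans htR), Real.rpow_natCast]
  have h3 := (abs_nonneg _).trans (hc n)
  rw [mul_pow, ← mul_div_assoc, ← mul_div_assoc, ← mul_assoc, ← h2]
  gcongr
  exact hc n

theorem summable_mul_pow_div_Gamma (hα : 0 < α) (hβ : 0 < β) (hC : 0 ≤ C) {R : ℝ} (hR : 0 ≤ R) :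
    Summable fun n : ℕ => B * ((C * R ^ α) ^ n / Real.Gamma (α * n + β)) :=
  (summable_pow_div_Gamma hα hβ (by positivity)).mul_left B

theorem summable_abs_mul_rpow_div_Gamma (hα : 0 < α) (hβ : 0 < β) (hC : 0 ≤ C)
    (hc : ∀ n, |c n| ≤ B * C ^ n) {t : ℝ} (ht : 0 ≤ t) :
    Summable fun n : ℕ => |c n| * (t ^ (α * n) / Real.Gamma (α * n + β)) := by
  refine Summable.of_nonneg_of_le (fun n => ?_)
    (abs_mul_rpow_div_Gamma_le hα hβ hc ht le_rfl) (summable_mul_pow_div_Gamma hα hβ hC ht)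
  have hG := Real.Gamma_pos_of_pos (show 0 < α * n + β by positivity)
  positivity

theorem rpow_div_Gamma_eq {t : ℝ} (ht : 0 < t) (n : ℕ) :
    t ^ (α * n + β - 1) / Real.Gamma (α * n + β) =
      t ^ (β - 1) * (t ^ (α * n) / Real.Gamma (α * n + β)) := by
  rw [add_sub_assoc, Real.rpow_add ht]; ring

theorem summable_abs_mittagLeffler (hα : 0 < α) (hβ : 0 < β) (hC : 0 ≤ C)
    (hc : ∀ n, |c n| ≤ B * C ^ n) {t : ℝ} (ht : 0 < t) :
    Summable fun n : ℕ => |c n| * (t ^ (α * n + β - 1) / Real.Gamma (α * n + β)) := by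
  have := (summable_abs_mul_rpow_div_Gamma hα hβ hC hc ht.le).mul_left (t ^ (β - 1))
  refine this.congr fun n => ?_
  rw [rpow_div_Gamma_eq ht]; ring

theorem hasSum_mittagLefflerSeries (hα : 0 < α) (hβ : 0 < β) (hC : 0 ≤ C)
    (hc : ∀ n, |c n| ≤ B * C ^ n) {t : ℝ} (ht : 0 < t) :
    HasSum (fun n : ℕ => c n * (t ^ (α * n + β - 1) / Real.Gamma (α * n + β)))
      (mittagLefflerSeries α β c t) := by
  refine (Summable.of_norm ?_).hasSum
  refine (summable_abs_mittagLeffler hα hβ hC hc ht).congr fun n => ?_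
  have hG := Real.Gamma_pos_of_pos (show 0 < α * n + β by positivity)
  rw [norm_mul, Real.norm_eq_abs, Real.norm_of_nonneg (by positivity)]

theorem continuousOn_tsum_rpow_div_Gamma (hα : 0 < α) (hβ : 0 < β) (hC : 0 ≤ C)
    (hc : ∀ n, |c n| ≤ B * C ^ n) :
    ContinuousOn (fun t => ∑' n : ℕ, c n * (t ^ (α * n) / Real.Gamma (α * n + β))) (Ici 0) := by
  intro t ht
  have ht' : (0 : ℝ) ≤ t := ht
  have h1 : ContinuousOn (fun t => ∑' n : ℕ, c n * (t ^ (α * n) / Real.Gamma (α * n + β)))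
      (Icc 0 (t + 1)) := by
    refine continuousOn_tsum (fun n => ?_)
      (summable_mul_pow_div_Gamma (B := B) hα hβ hC (R := t + 1) (by linarith)) fun n x hx => ?_
    · refine ContinuousOn.mul continuousOn_const (ContinuousOn.div_const ?_ _)
      exact continuousOn_id.rpow_const fun x _ => Or.inr (by positivity)
    · refine le_trans (le_of_eq ?_) (abs_mul_rpow_div_Gamma_le hα hβ hc hx.1 hx.2 n)
      have hG := Real.Gamma_pos_of_pos (show 0 < α * n + β by positivity)
      have := hx.1
      rw [norm_mul, Real.norm_eq_abs, Real.norm_of_nonneg (by positivity)]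
  refine (h1 t ⟨ht', by linarith⟩).mono_of_mem_nhdsWithin ?_
  rw [← Ici_inter_Iic]
  exact inter_mem self_mem_nhdsWithin (mem_nhdsWithin_of_mem_nhds (Iic_mem_nhds (by linarith)))

theorem mittagLefflerSeries_one (c : ℕ → ℝ) (t : ℝ) : mittagLefflerSeries α 1 c t =
    ∑' n : ℕ, c n * (t ^ (α * n) / Real.Gamma (α * n + 1)) := by
  simp [mittagLefflerSeries]

theorem continuousOn_mittagLefflerSeries_one (hα : 0 < α) (hC : 0 ≤ C)
    (hc : ∀ n, |c n| ≤ B * C ^ n) :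
    ContinuousOn (mittagLefflerSeries α 1 c) (Ici 0) := by
  refine (continuousOn_tsum_rpow_div_Gamma hα one_pos hC hc).congr fun t _ => ?_
  exact mittagLefflerSeries_one c t

theorem continuousOn_mittagLefflerSeries (hα : 0 < α) (hβ : 0 < β) (hC : 0 ≤ C)
    (hc : ∀ n, |c n| ≤ B * C ^ n) :
    ContinuousOn (mittagLefflerSeries α β c) (Ioi 0) := by
  have h := (continuousOn_tsum_rpow_div_Gamma hα hβ hC hc).mono Ioi_subset_Ici_self
  have h2 : ContinuousOn (fun t : ℝ => t ^ (β - 1)) (Ioi 0) :=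
    continuousOn_id.rpow_const fun x hx => Or.inl (ne_of_gt hx)
  refine (h2.mul h).congr fun t ht => ?_
  simp only [mittagLefflerSeries, Pi.mul_apply]
  rw [← tsum_mul_left]
  refine tsum_congr fun n => ?_
  rw [rpow_div_Gamma_eq ht]; ring

theorem mittagLefflerSeries_zero (hα : 0 < α) : mittagLefflerSeries α 1 c 0 = c 0 := by
  rw [mittagLefflerSeries_one, tsum_eq_single 0]
  · simp
  · intro n hn
    have : α * n ≠ 0 := by positivity
    rw [Real.zero_rpow this]; simp

theorem abs_mittagLefflerSeries_one_le (hα : 0 < α) (hC : 0 ≤ C)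
    (hc : ∀ n, |c n| ≤ B * C ^ n) {t R : ℝ} (ht : 0 ≤ t) (htR : t ≤ R) :
    |mittagLefflerSeries α 1 c t| ≤
      ∑' n : ℕ, B * ((C * R ^ α) ^ n / Real.Gamma (α * n + 1)) := by
  rw [mittagLefflerSeries_one, ← Real.norm_eq_abs]
  refine tsum_of_norm_bounded
    (summable_mul_pow_div_Gamma hα one_pos hC (ht.trans htR)).hasSum fun n => ?_
  refine le_trans (le_of_eq ?_) (abs_mul_rpow_div_Gamma_le hα one_pos hc ht htR n)
  have hG := Real.Gamma_pos_of_pos (show 0 < α * n + 1 by positivity)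
  rw [norm_mul, Real.norm_eq_abs, Real.norm_of_nonneg (by positivity)]

theorem mittagLefflerSeries_one_eq_add (hα : 0 < α) (hC : 0 ≤ C)
    (hc : ∀ n, |c n| ≤ B * C ^ n) {t : ℝ} (ht : 0 < t) :
    mittagLefflerSeries α 1 c t =
      c 0 + mittagLefflerSeries α (α + 1) (fun n => c (n + 1)) t := by
  have h := (hasSum_mittagLefflerSeries hα one_pos hC hc ht).summable
  rw [mittagLefflerSeries, h.tsum_eq_zero_add]
  congr 1
  · simp
  · refine tsum_congr fun n => ?_
    push_cast
    rw [show α * ((n : ℝ) + 1) + 1 = α * n + (α + 1) by ring]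

/-- Riemann-Liouville integration of a Mittag-Leffler series, term by term through the beta
integral. -/
theorem integral_sub_rpow_mul_mittagLefflerSeries {γ : ℝ} (hα : 0 < α) (hβ : 0 < β) (hγ : 0 < γ)
    (hC : 0 ≤ C) (hc : ∀ n, |c n| ≤ B * C ^ n) {t : ℝ} (ht : 0 < t) :
    IntervalIntegrable (fun y => (t - y) ^ (γ - 1) * mittagLefflerSeries α β c y) volume 0 t ∧
    ∫ y in (0 : ℝ)..t, (t - y) ^ (γ - 1) * mittagLefflerSeries α β c y =
      Real.Gamma γ * mittagLefflerSeries α (β + γ) c t := by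
  have hGγ := Real.Gamma_pos_of_pos hγ
  set F : ℕ → ℝ → ℝ := fun n y =>
    c n / Real.Gamma (α * n + β) * ((t - y) ^ (γ - 1) * y ^ (α * n + β - 1)) with hFdef
  have hpos : ∀ n : ℕ, 0 < α * n + β := fun n => by positivity
  have hF_int : ∀ n, Integrable (F n) (volume.restrict (Ioc 0 t)) := fun n =>
    ((intervalIntegrable_iff_integrableOn_Ioc_of_le ht.le).1
      (intervalIntegrable_sub_rpow_mul_rpow hγ (hpos n) ht)).const_mul _
  have hval : ∀ n : ℕ, ∫ y in Ioc 0 t, (t - y) ^ (γ - 1) * y ^ (α * n + β - 1) =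
      Real.Gamma γ * Real.Gamma (α * n + β) *
        (t ^ (α * n + (β + γ) - 1) / Real.Gamma (α * n + (β + γ))) := fun n => by
    rw [← intervalIntegral.integral_of_le ht.le, integral_sub_rpow_mul_rpow hγ (hpos n) ht,
      show γ + (α * n + β) = α * n + (β + γ) by ring]
    ring
  have hnorm : ∀ n, ∫ y in Ioc 0 t, ‖F n y‖ =
      Real.Gamma γ * (|c n| * (t ^ (α * n + (β + γ) - 1) / Real.Gamma (α * n + (β + γ)))) := by
    intro n
    have hG := Real.Gamma_pos_of_pos (hpos n)
    have : ∫ y in Ioc 0 t, ‖F n y‖ = ∫ y in Ioc 0 t, |c n| / Real.Gamma (α * n + β) *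
        ((t - y) ^ (γ - 1) * y ^ (α * n + β - 1)) := by
      refine setIntegral_congr_fun measurableSet_Ioc fun y hy => ?_
      have h1 := sub_nonneg.2 hy.2
      have h2 := hy.1
      simp only [hFdef]
      rw [norm_mul, norm_div, Real.norm_eq_abs, Real.norm_of_nonneg hG.le,
        Real.norm_of_nonneg (by positivity)]
    rw [this, integral_const_mul, hval]
    field_simp
  have hsummable : Summable fun n => ∫ y in Ioc 0 t, ‖F n y‖ := by
    simp_rw [hnorm]
    exact (summable_abs_mittagLeffler hα (add_pos hβ hγ) hC hc ht).mul_left _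
  have hFsum : ∀ y ∈ Ioc 0 t, HasSum (fun n => F n y)
      ((t - y) ^ (γ - 1) * mittagLefflerSeries α β c y) := fun y hy => by
    have := (hasSum_mittagLefflerSeries hα hβ hC hc hy.1).mul_left ((t - y) ^ (γ - 1))
    refine this.congr_fun fun n => ?_
    simp only [hFdef]; ring
  have hcongr : ∀ y ∈ Ioc 0 t, ∑' n, F n y = (t - y) ^ (γ - 1) * mittagLefflerSeries α β c y :=
    fun y hy => (hFsum y hy).tsum_eq
  have hmeas : AEStronglyMeasurable (fun y => ∑' n, F n y) (volume.restrict (Ioc 0 t)) := by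
    have h1 : AEStronglyMeasurable (mittagLefflerSeries α β c) (volume.restrict (Ioc 0 t)) :=
      ((continuousOn_mittagLefflerSeries hα hβ hC hc).mono
        (fun y hy => hy.1)).aestronglyMeasurable measurableSet_Ioc
    have h2 : AEStronglyMeasurable (fun y : ℝ => (t - y) ^ (γ - 1))
        (volume.restrict (Ioc 0 t)) := by
      have : Measurable fun y : ℝ => (t - y) ^ (γ - 1) := by fun_prop
      exact this.aestronglyMeasurable
    refine (h2.mul h1).congr ?_
    filter_upwards [self_mem_ae_restrict measurableSet_Ioc] with y hy
    exact (hcongr y hy).symm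
  have hint := integrable_tsum_of_summable_integral_norm hmeas hF_int hsummable
  refine ⟨?_, ?_⟩
  · rw [intervalIntegrable_iff_integrableOn_Ioc_of_le ht.le]
    exact hint.congr (by
      filter_upwards [self_mem_ae_restrict measurableSet_Ioc] with y hy
      exact hcongr y hy)
  · have h := hasSum_integral_of_summable_integral_norm hF_int hsummable
    rw [intervalIntegral.integral_of_le ht.le]
    rw [setIntegral_congr_fun measurableSet_Ioc hcongr] at h
    rw [← h.tsum_eq, mittagLefflerSeries, ← tsum_mul_left]
    refine tsum_congr fun n => ?_
    simp only [hFdef]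
    rw [integral_const_mul, hval]
    have hG := Real.Gamma_pos_of_pos (hpos n)
    field_simp

end

/-! ### The Caputo derivative and the Volterra equation -/

theorem AbsolutelyContinuousOnInterval.of_eq_const_add {f g : ℝ → ℝ} {a b c : ℝ}
    (hf : AbsolutelyContinuousOnInterval f a b) (h : ∀ x ∈ uIcc a b, g x = c + f x) :
    AbsolutelyContinuousOnInterval g a b := by
  rw [absolutelyContinuousOnInterval_iff] at hf ⊢
  intro ε hε
  obtain ⟨δ, hδ, H⟩ := hf ε hε
  refine ⟨δ, hδ, fun E hE hlt => ?_⟩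
  refine lt_of_le_of_lt (le_of_eq ?_) (H E hE hlt)
  refine Finset.sum_congr rfl fun j hj => ?_
  have := hE.1 j hj
  rw [h _ this.1, h _ this.2, dist_add_left]

/-- The Caputo derivative at `t > 0` depends only on the values on `[0, ∞)`. -/
theorem HasCaputoDerivAt.congr {α g t : ℝ} {f₁ f₂ : ℝ → ℝ} (ht : 0 < t)
    (h : HasCaputoDerivAt α f₁ g t) (heq : EqOn f₂ f₁ (Ici 0)) : HasCaputoDerivAt α f₂ g t := by
  have hev : ∀ y, 0 < y → f₂ =ᶠ[𝓝 y] f₁ := fun y hy => by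
    filter_upwards [Ioi_mem_nhds hy] with x hx using heq (mem_Ici.2 (le_of_lt hx))
  have hd : EqOn (fun y => (t - y) ^ (-α) * deriv f₁ y) (fun y => (t - y) ^ (-α) * deriv f₂ y)
      (uIoc 0 t) := fun y hy => by
    rw [uIoc_of_le ht.le] at hy
    simp only [(hev y hy.1).deriv_eq]
  unfold HasCaputoDerivAt at h ⊢
  split_ifs with hα
  · rw [if_pos hα] at h
    exact h.congr_of_eventuallyEq (hev t ht)
  · rw [if_neg hα] at h
    refine ⟨h.1.of_eq_const_add (c := 0) fun x hx => ?_, h.2.1.congr hd, ?_⟩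
    · rw [uIcc_of_le ht.le] at hx
      rw [heq hx.1, zero_add]
    · rw [h.2.2]
      congr 1
      refine intervalIntegral.integral_congr_ae (ae_of_all _ fun y hy => hd hy)

/-- The Riemann-Liouville integral of order `α` inverts the Caputo derivative of order `α < 1`. -/
theorem integral_sub_rpow_mul_caputoDeriv {α t : ℝ} {f h : ℝ → ℝ} (hα₀ : 0 < α) (hα₁ : α < 1)
    (ht : 0 < t) (hf : ∀ y, 0 < y → HasCaputoDerivAt α f (h y) y) :
    ∫ y in (0 : ℝ)..t, (t - y) ^ (α - 1) * h y = Real.Gamma α * (f t - f 0) := by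
  simp only [HasCaputoDerivAt, if_neg hα₁.ne] at hf
  set g := deriv f with hg
  have hGα := Real.Gamma_pos_of_pos hα₀
  have hGα' := Real.Gamma_pos_of_pos (sub_pos.2 hα₁)
  have hftc := (hf t ht).1.integral_deriv_eq_sub
  have hgint := (hf t ht).1.intervalIntegrable_deriv
  rw [intervalIntegrable_iff_integrableOn_Ioc_of_le ht.le] at hgint
  rw [intervalIntegral.integral_of_le ht.le] at hftc ⊢
  set μ : Measure ℝ := volume.restrict (Ioc 0 t) with hμ
  -- Fubini on the triangle `z < y`, where the kernel `κ` has the beta integral `Γ α * Γ (1 - α)`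
  -- in `y`, independently of `z`.
  set κ : ℝ → ℝ → ℝ := fun y z =>
    (Ioi z).indicator (fun y => (t - y) ^ (α - 1) * (y - z) ^ (1 - α - 1)) y with hκ
  have hκ_meas : Measurable (Function.uncurry κ) := by
    have : Function.uncurry κ = {p : ℝ × ℝ | p.2 < p.1}.indicator
        (fun p => (t - p.1) ^ (α - 1) * (p.1 - p.2) ^ (1 - α - 1)) := by
      ext ⟨y, z⟩
      simp [hκ, indicator, Function.uncurry]
    rw [this]
    refine Measurable.indicator (by fun_prop) (measurableSet_lt measurable_snd measurable_fst)
  have hz : ∀ z, 0 < z → z < t → Integrable (fun y => κ y z) μ ∧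
      ∫ y, κ y z ∂μ = Real.Gamma α * Real.Gamma (1 - α) := by
    intro z hz0 hzt
    have hset : Ioi z ∩ Ioc 0 t = Ioc z t := by
      ext y; simp only [mem_inter_iff, mem_Ioi, mem_Ioc]; grind
    constructor
    · rw [hκ, hμ]
      rw [integrable_indicator_iff measurableSet_Ioi, IntegrableOn,
        Measure.restrict_restrict measurableSet_Ioi, hset]
      exact (intervalIntegrable_iff_integrableOn_Ioc_of_le hzt.le).1
        (intervalIntegrable_sub_rpow_mul_sub_rpow hα₀ (sub_pos.2 hα₁) hzt)
    · rw [hκ, hμ]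
      rw [integral_indicator measurableSet_Ioi, Measure.restrict_restrict measurableSet_Ioi, hset,
        ← intervalIntegral.integral_of_le hzt.le,
        integral_sub_rpow_mul_sub_rpow hα₀ (sub_pos.2 hα₁) hzt]
      simp
  have hae : ∀ᵐ z ∂μ, 0 < z ∧ z < t := by
    rw [hμ, ← restrict_Ioo_eq_restrict_Ioc]
    exact self_mem_ae_restrict measurableSet_Ioo
  have hκ_nonneg : ∀ y ∈ Ioc 0 t, ∀ z, 0 ≤ κ y z := by
    intro y hy z
    refine indicator_apply_nonneg fun hyz => ?_
    have h1 : 0 ≤ t - y := sub_nonneg.2 hy.2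
    have h2 : 0 ≤ y - z := sub_nonneg.2 (le_of_lt hyz)
    positivity
  have hint : Integrable (Function.uncurry fun y z => κ y z * g z) (μ.prod μ) := by
    have hm : Measurable (Function.uncurry fun y z => κ y z * g z) :=
      hκ_meas.mul ((measurable_deriv f).comp measurable_snd)
    rw [integrable_prod_iff' hm.aestronglyMeasurable]
    constructor
    · filter_upwards [hae] with z hz'
      exact (hz z hz'.1 hz'.2).1.mul_const (g z)
    · have : Integrable (fun z => Real.Gamma α * Real.Gamma (1 - α) * ‖g z‖) μ :=
        hgint.norm.const_mul _
      refine this.congr ?_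
      filter_upwards [hae] with z hz'
      rw [← (hz z hz'.1 hz'.2).2, ← integral_mul_const]
      refine setIntegral_congr_fun measurableSet_Ioc fun y hy => ?_
      simp only [Function.uncurry]
      rw [norm_mul, Real.norm_of_nonneg (hκ_nonneg y hy z)]
  have hswap := integral_integral_swap hint
  have hleft : ∀ y ∈ Ioc 0 t, ∫ z, κ y z * g z ∂μ =
      Real.Gamma (1 - α) * ((t - y) ^ (α - 1) * h y) := by
    intro y hy
    have hset : Iio y ∩ Ioc 0 t = Ioo 0 y := by
      ext z; simp only [mem_inter_iff, mem_Iio, mem_Ioc, mem_Ioo]; grind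
    have h1 : ∀ z, κ y z * g z = (Iio y).indicator
        (fun z => (t - y) ^ (α - 1) * ((y - z) ^ (-α) * g z)) z := by
      intro z
      by_cases hzy : z < y
      · simp only [hκ, indicator, mem_Ioi, mem_Iio, hzy, if_true]
        rw [show 1 - α - 1 = -α by ring]; ring
      · simp [hκ, indicator, hzy]
    simp_rw [h1]
    rw [integral_indicator measurableSet_Iio, hμ, Measure.restrict_restrict measurableSet_Iio, hset,
      restrict_Ioo_eq_restrict_Ioc, integral_const_mul, ← intervalIntegral.integral_of_le hy.1.le,
      (hf y hy.1).2.2]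
    field_simp
  have hL : ∫ y, ∫ z, κ y z * g z ∂μ ∂μ =
      Real.Gamma (1 - α) * ∫ y in Ioc 0 t, (t - y) ^ (α - 1) * h y := by
    rw [← integral_const_mul]
    exact setIntegral_congr_fun measurableSet_Ioc hleft
  have hR : ∫ z, ∫ y, κ y z * g z ∂μ ∂μ =
      Real.Gamma (1 - α) * (Real.Gamma α * (f t - f 0)) := by
    rw [← hftc, ← mul_assoc, ← integral_const_mul]
    refine integral_congr_ae ?_
    filter_upwards [hae] with z hz'
    rw [integral_mul_const, (hz z hz'.1 hz'.2).2]; ring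
  rw [hL, hR] at hswap
  exact mul_left_cancel₀ hGα'.ne' hswap

/-! ### The queue operator -/

/-- The right-hand side of the M/M/1 system as an operator on sequences `ℕ → ℝ`. -/
def queueOp (lam mu : ℝ) (q : ℕ → ℝ) (k : ℕ) : ℝ := queueRHS lam mu (fun j _ => q j) k 0

section
variable {α lam mu : ℝ} {i : ℕ}

theorem queueRHS_eq_queueOp (p : ℕ → ℝ → ℝ) (k : ℕ) (t : ℝ) :
    queueRHS lam mu p k t = queueOp lam mu (fun j => p j t) k := by
  cases k <;> rfl

theorem queueOp_sub (p q : ℕ → ℝ) (k : ℕ) :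
    queueOp lam mu (fun j => p j - q j) k = queueOp lam mu p k - queueOp lam mu q k := by
  cases k <;> simp only [queueOp, queueRHS] <;> ring

theorem queueOp_smul (r : ℝ) (q : ℕ → ℝ) (k : ℕ) :
    queueOp lam mu (fun j => q j * r) k = queueOp lam mu q k * r := by
  cases k <;> simp only [queueOp, queueRHS] <;> ring

theorem hasSum_queueOp {F : ℕ → ℕ → ℝ} {q : ℕ → ℝ} (h : ∀ k, HasSum (fun n => F n k) (q k))
    (k : ℕ) : HasSum (fun n => queueOp lam mu (F n) k) (queueOp lam mu q k) := by
  cases k with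
  | zero => exact ((h 0).mul_left _).add ((h 1).mul_left _)
  | succ k => exact (((h (k + 1)).mul_left _).add ((h k).mul_left _)).add ((h (k + 2)).mul_left _)

theorem abs_queueOp_le (hlam : 0 < lam) (hmu : 0 < mu) {q : ℕ → ℝ} {M : ℝ} (h : ∀ k, |q k| ≤ M)
    (k : ℕ) : |queueOp lam mu q k| ≤ 2 * (lam + mu) * M := by
  have hM : 0 ≤ M := (abs_nonneg _).trans (h 0)
  cases k with
  | zero =>
    simp only [queueOp, queueRHS]
    have h0 := abs_le.1 (h 0)
    have h1 := abs_le.1 (h 1)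
    rw [abs_le]
    constructor <;> nlinarith
  | succ k =>
    simp only [queueOp, queueRHS]
    have h0 := abs_le.1 (h k)
    have h1 := abs_le.1 (h (k + 1))
    have h2 := abs_le.1 (h (k + 2))
    rw [abs_le]
    constructor <;> nlinarith

theorem continuousOn_queueRHS {p : ℕ → ℝ → ℝ} {s : Set ℝ} (hp : ∀ k, ContinuousOn (p k) s)
    (k : ℕ) : ContinuousOn (queueRHS lam mu p k) s := by
  cases k with
  | zero => exact (continuousOn_const.mul (hp 0)).add (continuousOn_const.mul (hp 1))
  | succ k =>
    exact ((continuousOn_const.mul (hp (k + 1))).add (continuousOn_const.mul (hp k))).add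
      (continuousOn_const.mul (hp (k + 2)))

/-- The `n`-th iterate of the queue operator on the indicator sequence of the initial state `i`. -/
def queueCoeff (lam mu : ℝ) (i : ℕ) : ℕ → ℕ → ℝ
  | 0, k => if k = i then 1 else 0
  | n + 1, k => queueOp lam mu (queueCoeff lam mu i n) k

/-- The factor `1` gives the bound the form `B * C ^ n` used for Mittag-Leffler coefficients. -/
theorem abs_queueCoeff_le (hlam : 0 < lam) (hmu : 0 < mu) (n k : ℕ) :
    |queueCoeff lam mu i n k| ≤ 1 * (2 * (lam + mu)) ^ n := by
  rw [one_mul]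
  induction n generalizing k with
  | zero => simp only [queueCoeff, pow_zero]; split_ifs <;> simp
  | succ n ih =>
    rw [queueCoeff, pow_succ, mul_comm]
    exact abs_queueOp_le hlam hmu ih k

/-- The Mittag-Leffler function of the (bounded) queue operator, applied to the initial state. -/
noncomputable def queueSolution (α lam mu : ℝ) (i k : ℕ) (t : ℝ) : ℝ :=
  mittagLefflerSeries α 1 (fun n => queueCoeff lam mu i n k) t

theorem queueRHS_queueSolution (hα : 0 < α) (hlam : 0 < lam) (hmu : 0 < mu) {t : ℝ} (ht : 0 < t)
    (k : ℕ) : queueRHS lam mu (queueSolution α lam mu i) k t =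
      mittagLefflerSeries α 1 (fun n => queueCoeff lam mu i (n + 1) k) t := by
  rw [queueRHS_eq_queueOp]
  have h := hasSum_queueOp (lam := lam) (mu := mu) (fun k => hasSum_mittagLefflerSeries hα one_pos
    (by positivity) (fun n => abs_queueCoeff_le (i := i) hlam hmu n k) ht) k
  refine h.tsum_eq.symm.trans ?_
  exact tsum_congr fun n => queueOp_smul _ _ _

theorem solvesQueueSystem_queueSolution (hα₀ : 0 < α) (hα₁ : α ≤ 1) (hlam : 0 < lam)
    (hmu : 0 < mu) : SolvesQueueSystem α lam mu i (queueSolution α lam mu i) := by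
  have hC : 0 ≤ 2 * (lam + mu) := by positivity
  have hc := fun k n => abs_queueCoeff_le (i := i) hlam hmu n k
  have hc' : ∀ k n, |queueCoeff lam mu i (n + 1) k| ≤ 2 * (lam + mu) * (2 * (lam + mu)) ^ n :=
    fun k n => (hc k (n + 1)).trans (le_of_eq (by ring))
  refine ⟨fun k => continuousOn_mittagLefflerSeries_one hα₀ hC (hc k), fun k t ht => ?_, fun k => ?_⟩
  · set g := mittagLefflerSeries α α (fun n => queueCoeff lam mu i (n + 1) k) with hg
    have hg_cont : ContinuousOn g (Ioi 0) := continuousOn_mittagLefflerSeries hα₀ hα₀ hC (hc' k)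
    have hgI : ∀ x, 0 < x → IntervalIntegrable g volume 0 x ∧ ∫ y in (0 : ℝ)..x, g y =
        mittagLefflerSeries α (α + 1) (fun n => queueCoeff lam mu i (n + 1) k) x := fun x hx => by
      have := integral_sub_rpow_mul_mittagLefflerSeries hα₀ hα₀ one_pos hC (hc' k) hx
      simpa using this
    have hp : ∀ x, 0 ≤ x → queueSolution α lam mu i k x =
        queueCoeff lam mu i 0 k + ∫ y in (0 : ℝ)..x, g y := by
      intro x hx
      rcases hx.eq_or_lt with rfl | hx
      · simp [queueSolution, mittagLefflerSeries_zero hα₀]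
      · rw [(hgI x hx).2]
        exact mittagLefflerSeries_one_eq_add hα₀ hC (hc k) hx
    have hderiv : ∀ x, 0 < x → HasDerivAt (queueSolution α lam mu i k) (g x) x := by
      intro x hx
      have h1 := intervalIntegral.integral_hasDerivAt_right (hgI x hx).1
        (hg_cont.stronglyMeasurableAtFilter isOpen_Ioi x hx)
        (hg_cont.continuousAt (Ioi_mem_nhds hx))
      refine (h1.const_add (queueCoeff lam mu i 0 k)).congr_of_eventuallyEq ?_
      filter_upwards [Ioi_mem_nhds hx] with y hy using hp y (le_of_lt hy)
    rw [queueRHS_queueSolution hα₀ hlam hmu ht]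
    unfold HasCaputoDerivAt
    split_ifs with hα
    · subst hα
      exact hderiv t ht
    · have hα' : 0 < 1 - α := sub_pos.2 (lt_of_le_of_ne hα₁ hα)
      have hRL := integral_sub_rpow_mul_mittagLefflerSeries hα₀ hα₀ hα' hC (hc' k) ht
      have hd : EqOn (fun y => (t - y) ^ (1 - α - 1) * g y)
          (fun y => (t - y) ^ (-α) * deriv (queueSolution α lam mu i k) y) (uIoc 0 t) := by
        intro y hy
        rw [uIoc_of_le ht.le] at hy
        simp only
        rw [(hderiv y hy.1).deriv, show 1 - α - 1 = -α by ring]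
      refine ⟨?_, hRL.1.congr hd, ?_⟩
      · refine ((hgI t ht).1.absolutelyContinuousOnInterval_intervalIntegral (c := 0)
          left_mem_uIcc).of_eq_const_add (c := queueCoeff lam mu i 0 k) fun x hx => ?_
        rw [uIcc_of_le ht.le] at hx
        exact hp x hx.1
      · rw [← intervalIntegral.integral_congr_ae (ae_of_all _ fun y hy => hd hy), hRL.2,
          add_sub_cancel]
        have := Real.Gamma_pos_of_pos hα'
        field_simp
  · rw [queueSolution, mittagLefflerSeries_zero hα₀, queueCoeff]

/-- Both the classical and the fractional system are equivalent to a Volterra equation with kernel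
`(t - y) ^ (α - 1) / Γ α`. -/
theorem SolvesQueueSystem.volterra (hα₀ : 0 < α) (hα₁ : α ≤ 1) {p : ℕ → ℝ → ℝ}
    (hp : SolvesQueueSystem α lam mu i p) (k : ℕ) {t : ℝ} (ht : 0 < t) :
    IntervalIntegrable (fun y => (t - y) ^ (α - 1) * queueRHS lam mu p k y) volume 0 t ∧
    ∫ y in (0 : ℝ)..t, (t - y) ^ (α - 1) * queueRHS lam mu p k y =
      Real.Gamma α * (p k t - p k 0) := by
  have hcont : ContinuousOn (queueRHS lam mu p k) (uIcc 0 t) := by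
    refine continuousOn_queueRHS (fun j => (hp.continuousOn j).mono fun x hx => ?_) k
    rw [uIcc_of_le ht.le] at hx
    exact hx.1
  have hker : IntervalIntegrable (fun y => (t - y) ^ (α - 1)) volume 0 t := by
    simpa using intervalIntegrable_sub_rpow_mul_rpow hα₀ one_pos ht
  refine ⟨hker.mul_continuousOn hcont, ?_⟩
  rcases hα₁.eq_or_lt with rfl | hα
  · have h0 : ContinuousOn (p k) (Icc 0 t) := (hp.continuousOn k).mono fun x hx => hx.1
    have h1 := intervalIntegral.integral_eq_sub_of_hasDerivAt_of_le ht.le h0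
      (fun x hx => by simpa [HasCaputoDerivAt] using hp.equation k x hx.1)
      hcont.intervalIntegrable
    simpa using h1
  · exact integral_sub_rpow_mul_caputoDeriv hα₀ hα ht fun y hy => hp.equation k y hy

/-- Uniqueness for the fractional system among locally uniformly bounded solutions: iterating the
Volterra equation bounds the difference by `B * (C * t ^ α) ^ n / Γ (α n + 1)` for every `n`. -/
theorem SolvesQueueSystem.unique (hα₀ : 0 < α) (hα₁ : α ≤ 1) (hlam : 0 < lam) (hmu : 0 < mu)
    {p q : ℕ → ℝ → ℝ} (hp : SolvesQueueSystem α lam mu i p) (hq : SolvesQueueSystem α lam mu i q)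
    (hb : ∀ R : ℝ, ∃ B, ∀ k, ∀ t ∈ Icc 0 R, |p k t - q k t| ≤ B) (k : ℕ) {t : ℝ} (ht : 0 ≤ t) :
    p k t = q k t := by
  obtain ⟨B, hB⟩ := hb t
  have hGα := Real.Gamma_pos_of_pos hα₀
  obtain ⟨C, hC, hop⟩ : ∃ C, 0 ≤ C ∧ ∀ (d : ℕ → ℝ) (M : ℝ), (∀ k, |d k| ≤ M) →
      ∀ k, |queueOp lam mu d k| ≤ C * M :=
    ⟨2 * (lam + mu), by positivity, fun _ _ => abs_queueOp_le hlam hmu⟩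
  have hB0 : 0 ≤ B := (abs_nonneg _).trans (hB 0 0 ⟨le_rfl, ht⟩)
  have key : ∀ n : ℕ, ∀ k, ∀ s ∈ Icc 0 t,
      |p k s - q k s| ≤ B * C ^ n * (s ^ (α * n) / Real.Gamma (α * n + 1)) := by
    intro n
    induction n with
    | zero => intro k s hs; simpa using hB k s hs
    | succ n ih =>
      intro k s hs
      have hG1 := Real.Gamma_pos_of_pos (show 0 < α * n + 1 by positivity)
      have hG2 := Real.Gamma_pos_of_pos (show 0 < α * (n + 1 : ℕ) + 1 by positivity)
      rcases hs.1.eq_or_lt with h0 | hs0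
      · rw [← h0, hp.initial, hq.initial, sub_self, abs_zero]
        positivity
      · have hp' := hp.volterra hα₀ hα₁ k hs0
        have hq' := hq.volterra hα₀ hα₁ k hs0
        have hsub : Real.Gamma α * (p k s - q k s) =
            ∫ y in (0 : ℝ)..s, (s - y) ^ (α - 1) * queueOp lam mu (fun j => p j y - q j y) k := by
          have h1 := intervalIntegral.integral_sub hp'.1 hq'.1
          rw [hp'.2, hq'.2, hp.initial, hq.initial] at h1
          rw [← mul_sub, sub_sub_sub_cancel_right] at h1
          rw [← h1]
          refine intervalIntegral.integral_congr fun y _ => ?_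
          simp only [queueOp_sub, queueRHS_eq_queueOp, mul_sub]
        have hint : IntervalIntegrable (fun y => C * (B * C ^ n / Real.Gamma (α * n + 1)) *
            ((s - y) ^ (α - 1) * y ^ (α * n + 1 - 1))) volume 0 s :=
          (intervalIntegrable_sub_rpow_mul_rpow hα₀ (by positivity) hs0).const_mul _
        have hle := intervalIntegral.norm_integral_le_of_norm_le hs0.le
          (f := fun y => (s - y) ^ (α - 1) * queueOp lam mu (fun j => p j y - q j y) k)
          (ae_of_all _ fun y hy => by
            have hy' : y ∈ Icc 0 t := ⟨hy.1.le, hy.2.trans hs.2⟩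
            have h1 := hop _ _ (fun j => ih j y hy') k
            have h2 : 0 ≤ (s - y) ^ (α - 1) := Real.rpow_nonneg (sub_nonneg.2 hy.2) _
            rw [norm_mul, Real.norm_of_nonneg h2, Real.norm_eq_abs, add_sub_cancel_right]
            refine (mul_le_mul_of_nonneg_left h1 h2).trans (le_of_eq ?_)
            ring) hint
        rw [← hsub, intervalIntegral.integral_const_mul,
          integral_sub_rpow_mul_rpow hα₀ (by positivity) hs0, norm_mul,
          Real.norm_of_nonneg hGα.le, Real.norm_eq_abs] at hle
        refine le_of_mul_le_mul_left (hle.trans (le_of_eq ?_)) hGα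
        rw [show α + (α * n + 1) = α * (n + 1 : ℕ) + 1 by push_cast; ring, add_sub_cancel_right]
        field_simp
        ring
  have hlim : Tendsto (fun n : ℕ => B * ((C * t ^ α) ^ n / Real.Gamma (α * n + 1))) atTop (𝓝 0) :=
    (summable_mul_pow_div_Gamma (B := B) hα₀ one_pos hC ht).tendsto_atTop_zero
  have hle : |p k t - q k t| ≤ 0 := by
    refine ge_of_tendsto' hlim fun n => (key n k t ⟨ht, le_rfl⟩).trans (le_of_eq ?_)
    rw [Real.rpow_mul ht, Real.rpow_natCast, mul_pow]
    ring
  exact sub_eq_zero.1 (abs_nonpos_iff.1 hle)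

end

/-! ### Uniqueness of the Laplace transform -/

/-- The moment generating functions extend analytically to the half-plane `re z < a`, which contains
the imaginary axis, where they are the characteristic functions. -/
theorem MeasureTheory.Measure.ext_of_mgf_eqOn_Iio {μ ν : Measure ℝ} [IsFiniteMeasure μ]
    [IsFiniteMeasure ν] {a : ℝ} (ha : 0 < a)
    (hμ : ∀ t < a, Integrable (fun x => Real.exp (t * x)) μ)
    (hν : ∀ t < a, Integrable (fun x => Real.exp (t * x)) ν)
    (h : ∀ t < a, ∫ x, Real.exp (t * x) ∂μ = ∫ x, Real.exp (t * x) ∂ν) : μ = ν := by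
  have hsub : ∀ ρ : Measure ℝ, (∀ t < a, Integrable (fun x => Real.exp (t * x)) ρ) →
      Iio a ⊆ interior (integrableExpSet id ρ) := fun ρ hρ =>
    interior_maximal (fun t ht => hρ t ht) isOpen_Iio
  have hana : ∀ ρ : Measure ℝ, (∀ t < a, Integrable (fun x => Real.exp (t * x)) ρ) →
      AnalyticOnNhd ℂ (complexMGF id ρ) {z | z.re < a} := fun ρ hρ =>
    analyticOnNhd_complexMGF.mono fun z hz => hsub ρ hρ hz
  have hconn : IsPreconnected {z : ℂ | z.re < a} :=
    ((convex_Iio a).linear_preimage Complex.reLm).isPreconnected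
  have hfreq : ∃ᶠ z in 𝓝[≠] (0 : ℂ), complexMGF id μ z = complexMGF id ν z := by
    have hreal : ∀ᶠ x : ℝ in 𝓝[≠] 0, complexMGF id μ x = complexMGF id ν x := by
      filter_upwards [mem_nhdsWithin_of_mem_nhds (Iio_mem_nhds ha)] with x hx
      rw [complexMGF_ofReal, complexMGF_ofReal]
      exact congrArg _ (h x hx)
    have ht : Tendsto (fun x : ℝ => (x : ℂ)) (𝓝[≠] 0) (𝓝[≠] 0) := by
      refine tendsto_nhdsWithin_iff.2 ⟨?_, ?_⟩
      · exact (Complex.continuous_ofReal.tendsto' 0 0 rfl).mono_left nhdsWithin_le_nhds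
      · filter_upwards [self_mem_nhdsWithin] with x hx
        simpa using hx
    exact ht.frequently hreal.frequently
  have heq := AnalyticOnNhd.eqOn_of_preconnected_of_frequently_eq (hana μ hμ) (hana ν hν) hconn
    (z₀ := 0) (by simpa using ha) hfreq
  refine Measure.ext_of_charFun (funext fun t => ?_)
  rw [← complexMGF_id_mul_I, ← complexMGF_id_mul_I]
  exact heq (by simpa using ha)

/-- A measure on `ℝ` with finite Laplace transform on `(0, ∞)` is determined by it. -/
theorem MeasureTheory.Measure.ext_of_lintegral_exp_neg {μ ν : Measure ℝ}
    (hfin : ∀ ξ : ℝ, 0 < ξ → ∫⁻ x, ENNReal.ofReal (Real.exp (-ξ * x)) ∂μ ≠ ∞)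
    (h : ∀ ξ : ℝ, 0 < ξ → ∫⁻ x, ENNReal.ofReal (Real.exp (-ξ * x)) ∂μ =
      ∫⁻ x, ENNReal.ofReal (Real.exp (-ξ * x)) ∂ν) : μ = ν := by
  -- Tilting by `exp (-x)` makes the measures finite and moves `0` into the interior of the
  -- domain of the moment generating functions.
  set w : ℝ → ℝ≥0∞ := fun x => ENNReal.ofReal (Real.exp (-1 * x)) with hw
  have hwm : Measurable w := by fun_prop
  have hl : ∀ (ρ : Measure ℝ) (t : ℝ), ∫⁻ x, ENNReal.ofReal (Real.exp (t * x)) ∂(ρ.withDensity w) =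
      ∫⁻ x, ENNReal.ofReal (Real.exp (-(1 - t) * x)) ∂ρ := by
    intro ρ t
    rw [lintegral_withDensity_eq_lintegral_mul _ hwm (by fun_prop)]
    refine lintegral_congr fun x => ?_
    rw [Pi.mul_apply, hw, ← ENNReal.ofReal_mul (Real.exp_pos _).le, ← Real.exp_add]
    ring_nf
  have hfin' : ∀ ξ : ℝ, 0 < ξ → ∫⁻ x, ENNReal.ofReal (Real.exp (-ξ * x)) ∂ν ≠ ∞ :=
    fun ξ hξ => h ξ hξ ▸ hfin ξ hξ
  have hI : ∀ ρ : Measure ℝ, (∀ ξ : ℝ, 0 < ξ →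
      ∫⁻ x, ENNReal.ofReal (Real.exp (-ξ * x)) ∂ρ ≠ ∞) → ∀ t < 1,
      Integrable (fun x => Real.exp (t * x)) (ρ.withDensity w) := by
    intro ρ hρ t ht
    refine (lintegral_ofReal_ne_top_iff_integrable (by fun_prop)
      (ae_of_all _ fun x => (Real.exp_pos _).le)).1 ?_
    rw [hl]
    exact hρ _ (sub_pos.2 ht)
  have hF : ∀ ρ : Measure ℝ, (∀ ξ : ℝ, 0 < ξ →
      ∫⁻ x, ENNReal.ofReal (Real.exp (-ξ * x)) ∂ρ ≠ ∞) → IsFiniteMeasure (ρ.withDensity w) :=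
    fun ρ hρ => isFiniteMeasure_withDensity (hρ 1 one_pos)
  have := hF μ hfin
  have := hF ν hfin'
  have key : μ.withDensity w = ν.withDensity w := by
    refine Measure.ext_of_mgf_eqOn_Iio one_pos (hI μ hfin) (hI ν hfin') fun t ht => ?_
    rw [integral_eq_lintegral_of_nonneg_ae (ae_of_all _ fun x => (Real.exp_pos _).le)
      (by fun_prop), integral_eq_lintegral_of_nonneg_ae (ae_of_all _ fun x => (Real.exp_pos _).le)
      (by fun_prop), hl, hl, h _ (sub_pos.2 ht)]
  have hw0 : ∀ x, w x ≠ 0 := fun x => by simp [hw, Real.exp_pos]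
  have hinv : ∀ ρ : Measure ℝ, (ρ.withDensity w).withDensity (fun x => (w x)⁻¹) = ρ := fun ρ =>
    withDensity_inv_same hwm (ae_of_all _ hw0) (ae_of_all _ fun x => ENNReal.ofReal_ne_top)
  rw [← hinv μ, key, hinv ν]

theorem lintegral_rpow_mul_exp_neg_mul_Ioi {a r : ℝ} (ha : 0 < a) (hr : 0 < r) :
    ∫⁻ t in Ioi (0 : ℝ), ENNReal.ofReal (t ^ (a - 1) * Real.exp (-(r * t))) =
      ENNReal.ofReal ((1 / r) ^ a * Real.Gamma a) := by
  have h := Real.integral_rpow_mul_exp_neg_mul_Ioi ha hr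
  have hG := Real.Gamma_pos_of_pos ha
  -- The Bochner integral is nonzero, so the integrand is integrable.
  have hint : Integrable (fun t : ℝ => t ^ (a - 1) * Real.exp (-(r * t)))
      (volume.restrict (Ioi 0)) := by
    by_contra hc
    rw [integral_undef hc] at h
    have : 0 < (1 / r) ^ a * Real.Gamma a := by positivity
    exact this.ne h
  rw [← h, ofReal_integral_eq_lintegral_ofReal hint]
  filter_upwards [self_mem_ae_restrict measurableSet_Ioi] with t ht
  have : (0 : ℝ) < t := ht
  simp only [Pi.zero_apply]
  positivity

/-! ### The inverse of a stable subordinator -/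

section
variable {Ω : Type*} {V : ℝ≥0 → Ω → ℝ}

theorem inverseProcess_le {t s : ℝ≥0} {ω : Ω} (hs : 0 < s) (h : (t : ℝ) < V s ω) :
    inverseProcess V t ω ≤ s :=
  csInf_le (OrderBot.bddBelow _) ⟨hs, h⟩

theorem le_inverseProcess {t s : ℝ≥0} {ω : Ω} (hmono : Monotone fun s => V s ω)
    (hne : ∃ n : ℕ, (t : ℝ) < V (n + 1) ω) (h : V s ω ≤ t) : s ≤ inverseProcess V t ω := by
  obtain ⟨n, hn⟩ := hne
  refine le_csInf ⟨n + 1, by positivity, hn⟩ fun r hr => ?_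
  by_contra hlt
  exact absurd (hmono (not_le.1 hlt).le) (not_le.2 (h.trans_lt hr.2))

variable [MeasurableSpace Ω] {P : Measure Ω} {α : ℝ}

theorem IsStableSubordinator.lintegral_exp (hV : IsStableSubordinator α V P) (s : ℝ≥0) {ξ : ℝ}
    (hξ : 0 < ξ) : ∫⁻ ω, ENNReal.ofReal (Real.exp (-ξ * V s ω)) ∂P =
      ENNReal.ofReal (Real.exp (-(s : ℝ) * ξ ^ α)) := by
  have h := hV.laplace s ξ hξ
  -- The Bochner integral is nonzero, so the integrand is integrable.
  have hint : Integrable (fun ω => Real.exp (-ξ * V s ω)) P := by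
    by_contra hc
    rw [integral_undef hc] at h
    exact (Real.exp_pos _).ne h
  rw [← h, ofReal_integral_eq_lintegral_ofReal hint (ae_of_all _ fun ω => (Real.exp_pos _).le)]

/-- By Markov's inequality `P (V s ≤ t) ≤ exp (t - s)`, so that `V` is almost surely unbounded and the
infimum defining the inverse process is not over the empty set. -/
theorem IsStableSubordinator.ae_exists_lt (hV : IsStableSubordinator α V P) (t : ℝ) :
    ∀ᵐ ω ∂P, ∃ n : ℕ, t < V (n + 1) ω := by
  have hle : ∀ n : ℕ, P {ω | ¬ ∃ n : ℕ, t < V (n + 1) ω} ≤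
      ENNReal.ofReal (Real.exp (t - (n + 1))) := by
    intro n
    have hm := mul_meas_ge_le_lintegral (μ := P)
      (f := fun ω => ENNReal.ofReal (Real.exp (-1 * V (n + 1) ω)))
      (by have := hV.measurable (n + 1); fun_prop) (ENNReal.ofReal (Real.exp (-t)))
    rw [hV.lintegral_exp _ one_pos] at hm
    have hsub : {ω | ¬ ∃ n : ℕ, t < V (n + 1) ω} ⊆
        {ω | ENNReal.ofReal (Real.exp (-t)) ≤ ENNReal.ofReal (Real.exp (-1 * V (n + 1) ω))} := by
      intro ω hω
      have hω' : ¬ ∃ n : ℕ, t < V (n + 1) ω := hω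
      push Not at hω'
      have := hω' n
      exact ENNReal.ofReal_le_ofReal (Real.exp_le_exp.2 (by linarith))
    calc P {ω | ¬ ∃ n : ℕ, t < V (n + 1) ω}
        = ENNReal.ofReal (Real.exp t) * (ENNReal.ofReal (Real.exp (-t)) *
          P {ω | ¬ ∃ n : ℕ, t < V (n + 1) ω}) := by
          rw [← mul_assoc, ← ENNReal.ofReal_mul (Real.exp_pos _).le, ← Real.exp_add]
          simp
      _ ≤ ENNReal.ofReal (Real.exp t) *
          ENNReal.ofReal (Real.exp (-((n + 1 : ℝ≥0) : ℝ) * 1 ^ α)) := by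
          gcongr
          exact (mul_le_mul_right (measure_mono hsub) _).trans hm
      _ = _ := by
          rw [← ENNReal.ofReal_mul (Real.exp_pos _).le, ← Real.exp_add]
          congr 2
          push_cast
          rw [Real.one_rpow]; ring
  have hlim : Tendsto (fun n : ℕ => ENNReal.ofReal (Real.exp (t - (n + 1)))) atTop (𝓝 0) := by
    rw [← ENNReal.ofReal_zero]
    refine ENNReal.tendsto_ofReal (Real.tendsto_exp_atBot.comp ?_)
    refine tendsto_const_nhds.add_atBot (tendsto_neg_atTop_atBot.comp ?_)
    exact tendsto_atTop_add_const_right _ _ tendsto_natCast_atTop_atTop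
  exact nonpos_iff_eq_zero.1 (ge_of_tendsto' hlim hle)

theorem IsStableSubordinator.aemeasurable_inverseProcess (hV : IsStableSubordinator α V P)
    (t : ℝ≥0) : AEMeasurable (inverseProcess V t) P := by
  -- By monotonicity of the paths, the infimum may be taken over rational times.
  set F : Ω → ℝ≥0∞ := fun ω => ⨅ q : ℚ, if 0 < Real.toNNReal q ∧ (t : ℝ) < V (Real.toNNReal q) ω
    then (Real.toNNReal q : ℝ≥0∞) else ⊤ with hF
  have hFm : Measurable F := by
    refine Measurable.iInf fun q => Measurable.ite ?_ measurable_const measurable_const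
    exact (MeasurableSet.const _).inter (measurableSet_lt measurable_const (hV.measurable _))
  refine ⟨fun ω => (F ω).toNNReal, hFm.ennreal_toNNReal, ?_⟩
  filter_upwards [hV.monotone, hV.ae_exists_lt t] with ω hmono hne
  have : F ω = (inverseProcess V t ω : ℝ≥0∞) := by
    refine le_antisymm ?_ (le_iInf fun q => ?_)
    · refine le_of_forall_gt fun r hr => ?_
      obtain ⟨x, hx1, hx2⟩ := ENNReal.lt_iff_exists_nnreal_btwn.1 hr
      obtain ⟨n, hn⟩ := hne
      obtain ⟨s, hs, hsx⟩ := exists_lt_of_csInf_lt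
        (show {s : ℝ≥0 | 0 < s ∧ (t : ℝ) < V s ω}.Nonempty from ⟨n + 1, by positivity, hn⟩)
        (ENNReal.coe_lt_coe.1 hx1)
      obtain ⟨q, -, hq1, hq2⟩ := (NNReal.lt_iff_exists_rat_btwn _ _).1 hsx
      refine lt_of_le_of_lt (iInf_le _ q) ?_
      rw [if_pos ⟨hs.1.trans hq1, hs.2.trans_le (hmono hq1.le)⟩]
      exact (ENNReal.coe_lt_coe.2 hq2).trans hx2
    · split_ifs with h
      · exact ENNReal.coe_le_coe.2 (inverseProcess_le h.1 h.2)
      · exact le_top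
  simp [this]

variable [IsProbabilityMeasure P]

/-- The laws of the subordinator form a kernel: `s ↦ P (V s ≤ x)` is antitone, hence measurable. -/
theorem IsStableSubordinator.measurable_map (hV : IsStableSubordinator α V P) :
    Measurable fun s : ℝ => P.map (V s.toNNReal) := by
  have : ∀ s : ℝ, IsProbabilityMeasure (P.map (V s.toNNReal)) := fun s =>
    Measure.isProbabilityMeasure_map (hV.measurable _).aemeasurable
  refine .measure_of_isPiSystem_of_isProbabilityMeasure (borel_eq_generateFrom_Iic ℝ)
    isPiSystem_Iic ?_
  rintro _ ⟨x, rfl⟩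
  refine Antitone.measurable fun s s' hss => ?_
  rw [Measure.map_apply (hV.measurable _) measurableSet_Iic,
    Measure.map_apply (hV.measurable _) measurableSet_Iic]
  refine measure_mono_ae ?_
  filter_upwards [hV.monotone] with ω hmono hω
  exact (hmono (Real.toNNReal_le_toNNReal hss)).trans hω

/-- The potential measure `∫ (n + 1) s ^ n P (V s ∈ ·) ds` of the subordinator has a power density:
both have Laplace transform `(n + 1)! ξ ^ (-α (n + 1))`. -/
theorem IsStableSubordinator.bind_map_eq (hα : 0 < α) (hV : IsStableSubordinator α V P) (n : ℕ) :
    ((volume.restrict (Ioi 0)).withDensity fun s : ℝ => ENNReal.ofReal ((n + 1) * s ^ n)).bind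
        (fun s => P.map (V s.toNNReal)) =
      (volume.restrict (Ioi 0)).withDensity fun x : ℝ => ENNReal.ofReal
        ((n + 1).factorial / Real.Gamma (α * (n + 1)) * x ^ (α * (n + 1) - 1)) := by
  have hα' : 0 < α * (n + 1) := by positivity
  have hG := Real.Gamma_pos_of_pos hα'
  have h1 : ∀ ξ : ℝ, 0 < ξ → ∫⁻ x, ENNReal.ofReal (Real.exp (-ξ * x))
      ∂(((volume.restrict (Ioi 0)).withDensity fun s : ℝ => ENNReal.ofReal ((n + 1) * s ^ n)).bind
        (fun s => P.map (V s.toNNReal))) =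
      ENNReal.ofReal ((n + 1).factorial * (1 / ξ) ^ (α * (n + 1))) := by
    intro ξ hξ
    rw [Measure.lintegral_bind hV.measurable_map.aemeasurable (by fun_prop)]
    have hinner : ∀ s : ℝ, ∫⁻ x, ENNReal.ofReal (Real.exp (-ξ * x)) ∂(P.map (V s.toNNReal)) =
        ENNReal.ofReal (Real.exp (-(s.toNNReal : ℝ) * ξ ^ α)) := fun s => by
      rw [lintegral_map (by fun_prop) (hV.measurable _), hV.lintegral_exp _ hξ]
    simp_rw [hinner]
    rw [lintegral_withDensity_eq_lintegral_mul _ (by fun_prop) (by fun_prop)]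
    have hcongr : ∫⁻ s in Ioi (0 : ℝ), ((fun s : ℝ => ENNReal.ofReal ((n + 1) * s ^ n)) *
        fun s : ℝ => ENNReal.ofReal (Real.exp (-(s.toNNReal : ℝ) * ξ ^ α))) s =
        ∫⁻ s in Ioi (0 : ℝ), ENNReal.ofReal (n + 1) *
          ENNReal.ofReal (s ^ ((n + 1 : ℝ) - 1) * Real.exp (-(ξ ^ α * s))) := by
      refine setLIntegral_congr_fun measurableSet_Ioi fun s hs => ?_
      have hs' : (0 : ℝ) < s := hs
      simp only [Pi.mul_apply]
      rw [← ENNReal.ofReal_mul (by positivity), ← ENNReal.ofReal_mul (by positivity),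
        Real.coe_toNNReal _ hs'.le, add_sub_cancel_right, Real.rpow_natCast]
      congr 1
      rw [mul_assoc]
      congr 3
      ring
    rw [hcongr, lintegral_const_mul _ (by fun_prop),
      lintegral_rpow_mul_exp_neg_mul_Ioi (by positivity) (by positivity),
      ← ENNReal.ofReal_mul (by positivity), Real.Gamma_nat_eq_factorial, Nat.factorial_succ]
    congr 1
    rw [Real.rpow_mul (by positivity), one_div, one_div, Real.inv_rpow hξ.le]
    push_cast
    ring
  have h2 : ∀ ξ : ℝ, 0 < ξ → ∫⁻ x, ENNReal.ofReal (Real.exp (-ξ * x))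
      ∂((volume.restrict (Ioi 0)).withDensity fun x : ℝ => ENNReal.ofReal
        ((n + 1).factorial / Real.Gamma (α * (n + 1)) * x ^ (α * (n + 1) - 1))) =
      ENNReal.ofReal ((n + 1).factorial * (1 / ξ) ^ (α * (n + 1))) := by
    intro ξ hξ
    rw [lintegral_withDensity_eq_lintegral_mul _ (by fun_prop) (by fun_prop)]
    have hcongr : ∫⁻ x in Ioi (0 : ℝ), ((fun x : ℝ => ENNReal.ofReal
        ((n + 1).factorial / Real.Gamma (α * (n + 1)) * x ^ (α * (n + 1) - 1))) *
        fun x => ENNReal.ofReal (Real.exp (-ξ * x))) x =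
        ∫⁻ x in Ioi (0 : ℝ), ENNReal.ofReal ((n + 1).factorial / Real.Gamma (α * (n + 1))) *
          ENNReal.ofReal (x ^ (α * (n + 1) - 1) * Real.exp (-(ξ * x))) := by
      refine setLIntegral_congr_fun measurableSet_Ioi fun s hs => ?_
      have hs' : (0 : ℝ) < s := hs
      simp only [Pi.mul_apply]
      rw [← ENNReal.ofReal_mul (by positivity), ← ENNReal.ofReal_mul (by positivity)]
      congr 1
      rw [mul_assoc, neg_mul]
    rw [hcongr, lintegral_const_mul _ (by fun_prop),
      lintegral_rpow_mul_exp_neg_mul_Ioi hα' hξ, ← ENNReal.ofReal_mul (by positivity)]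
    congr 1
    field_simp
  refine Measure.ext_of_lintegral_exp_neg (fun ξ hξ => ?_) fun ξ hξ => ?_
  · rw [h1 ξ hξ]; exact ENNReal.ofReal_ne_top
  · rw [h1 ξ hξ, h2 ξ hξ]

/-- The moments of the inverse stable subordinator. -/
theorem IsStableSubordinator.lintegral_inverseProcess_pow (hα : 0 < α)
    (hV : IsStableSubordinator α V P) (n : ℕ) (t : ℝ≥0) :
    ∫⁻ ω, ENNReal.ofReal ((inverseProcess V t ω : ℝ) ^ n) ∂P =
      ENNReal.ofReal (n.factorial * ((t : ℝ) ^ (α * n) / Real.Gamma (α * n + 1))) := by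
  cases n with
  | zero => simp
  | succ n =>
    have hα' : 0 < α * (n + 1) := by positivity
    have hG := Real.Gamma_pos_of_pos hα'
    have hE := hV.aemeasurable_inverseProcess t
    have hlc := lintegral_rpow_eq_lintegral_meas_lt_mul P
      (f := fun ω => (inverseProcess V t ω : ℝ)) (ae_of_all _ fun ω => NNReal.coe_nonneg _)
      hE.coe_nnreal_real (p := n + 1) (by positivity)
    -- `{E t > s} ⊆ {V s ≤ t} ⊆ {E t ≥ s}` up to null sets, and the outer events have the same
    -- probability except for countably many `s`.
    have hmeas : ∀ᵐ s : ℝ ∂volume.restrict (Ioi 0),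
        P {ω | s < (inverseProcess V t ω : ℝ)} = P {ω | V s.toNNReal ω ≤ t} := by
      filter_upwards [self_mem_ae_restrict measurableSet_Ioi,
        meas_le_ae_eq_meas_lt P (volume.restrict (Ioi 0))
          (fun ω => (inverseProcess V t ω : ℝ))] with s hs hs2
      have hs0 : (0 : ℝ) < s := hs
      refine le_antisymm (measure_mono fun ω hω => ?_) ?_
      · by_contra hlt
        have := inverseProcess_le (Real.toNNReal_pos.2 hs0) (not_le.1 hlt)
        rw [← NNReal.coe_le_coe, Real.coe_toNNReal _ hs0.le] at this
        exact absurd hω (not_lt.2 this)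
      · rw [← hs2]
        refine measure_mono_ae ?_
        filter_upwards [hV.monotone, hV.ae_exists_lt t] with ω hmono hne hω
        have := le_inverseProcess hmono hne hω
        rwa [← NNReal.coe_le_coe, Real.coe_toNNReal _ hs0.le] at this
    have hν := congrArg (fun μ : Measure ℝ => μ (Iic (t : ℝ))) (hV.bind_map_eq hα n)
    have hm : Measurable fun s : ℝ => P.map (V s.toNNReal) (Iic (t : ℝ)) :=
      (Measure.measurable_coe measurableSet_Iic).comp hV.measurable_map
    rw [Measure.bind_apply measurableSet_Iic hV.measurable_map.aemeasurable,
      lintegral_withDensity_eq_lintegral_mul _ (by fun_prop) hm,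
      withDensity_apply _ measurableSet_Iic, Measure.restrict_restrict measurableSet_Iic] at hν
    have hL : ∫⁻ s in Ioi (0 : ℝ), ((fun s : ℝ => ENNReal.ofReal ((n + 1) * s ^ n)) *
        fun s : ℝ => P.map (V s.toNNReal) (Iic (t : ℝ))) s =
        ∫⁻ ω, ENNReal.ofReal ((inverseProcess V t ω : ℝ) ^ (n + 1)) ∂P := by
      simp_rw [← Real.rpow_natCast, Nat.cast_add, Nat.cast_one, hlc]
      rw [← lintegral_const_mul' _ _ ENNReal.ofReal_ne_top]
      refine lintegral_congr_ae ?_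
      filter_upwards [self_mem_ae_restrict measurableSet_Ioi, hmeas] with s hs hs2
      have hs0 : (0 : ℝ) < s := hs
      rw [hs2, Pi.mul_apply, Measure.map_apply (hV.measurable _) measurableSet_Iic,
        ENNReal.ofReal_mul (by positivity), add_sub_cancel_right, mul_assoc, mul_comm (P _)]
      rfl
    have hR : ∫⁻ x in Iic (t : ℝ) ∩ Ioi 0, ENNReal.ofReal
        ((n + 1).factorial / Real.Gamma (α * (n + 1)) * x ^ (α * (n + 1) - 1)) =
        ENNReal.ofReal ((n + 1).factorial *
          ((t : ℝ) ^ (α * (n + 1)) / Real.Gamma (α * (n + 1) + 1))) := by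
      have hint : IntervalIntegrable (fun x : ℝ => (n + 1).factorial / Real.Gamma (α * (n + 1)) *
          x ^ (α * (n + 1) - 1)) volume 0 t :=
        (intervalIntegral.intervalIntegrable_rpow' (by linarith)).const_mul _
      rw [intervalIntegrable_iff_integrableOn_Ioc_of_le t.coe_nonneg] at hint
      rw [inter_comm, Ioi_inter_Iic, ← ofReal_integral_eq_lintegral_ofReal hint,
        ← intervalIntegral.integral_of_le t.coe_nonneg, intervalIntegral.integral_const_mul,
        integral_rpow (Or.inl (by linarith)), Real.Gamma_add_one hα'.ne', sub_add_cancel,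
        Real.zero_rpow hα'.ne']
      · congr 1
        field_simp
        ring
      · filter_upwards [self_mem_ae_restrict measurableSet_Ioc] with x hx
        have := hx.1
        simp only [Pi.zero_apply]
        positivity
    rw [hR] at hν
    rw [← hL]
    push_cast
    exact hν

end

/-! ### Random time changes -/

/-- Times in `[0, ∞)` are limits from the right of times `d m j` with countably many values, where
the index `j = J m x` depends measurably on the time `x`. -/
theorem NNReal.exists_discrete_approx : ∃ (d : ℕ → ℕ → ℝ≥0) (J : ℕ → ℝ≥0 → ℕ),
    (∀ m, Measurable (J m)) ∧ (∀ m x, x ≤ d m (J m x)) ∧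
      ∀ x, Tendsto (fun m => d m (J m x)) atTop (𝓝 x) := by
  have hle : ∀ (m : ℕ) (x : ℝ≥0),
      x ≤ ((⌊((m : ℝ≥0) + 1) * x⌋₊ : ℝ≥0) + 1) / ((m : ℝ≥0) + 1) := fun m x => by
    rw [le_div_iff₀ (by positivity), mul_comm]
    exact (Nat.lt_floor_add_one _).le
  have hup : ∀ (m : ℕ) (x : ℝ≥0),
      ((⌊((m : ℝ≥0) + 1) * x⌋₊ : ℝ≥0) + 1) / ((m : ℝ≥0) + 1) ≤ x + 1 / ((m : ℝ≥0) + 1) :=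
    fun m x => by
      rw [add_div]
      gcongr
      rw [div_le_iff₀ (by positivity), mul_comm]
      exact Nat.floor_le (by positivity)
  refine ⟨fun m j => ((j : ℝ≥0) + 1) / ((m : ℝ≥0) + 1), fun m x => ⌊((m : ℝ≥0) + 1) * x⌋₊,
    fun m => Nat.measurable_floor.comp (measurable_const.mul measurable_id), hle, fun x => ?_⟩
  refine tendsto_of_tendsto_of_tendsto_of_le_of_le tendsto_const_nhds ?_
    (fun m => hle m x) (fun m => hup m x)
  have h0 : Tendsto (fun m : ℕ => 1 / ((m : ℝ≥0) + 1)) atTop (𝓝 0) := by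
    rw [← NNReal.tendsto_coe]
    simpa using tendsto_one_div_add_atTop_nhds_zero_nat (𝕜 := ℝ)
  simpa using tendsto_const_nhds.add h0

/-- For a random time with countably many values, split the event according to the value. -/
theorem ProbabilityTheory.IndepFun.measureReal_discrete_time_change {Ω : Type*}
    [MeasurableSpace Ω] {P : Measure Ω} [IsProbabilityMeasure P] {N : ℝ≥0 → Ω → ℕ}
    (hN : ∀ t, Measurable (N t)) {τ : Ω → ℝ≥0} (hτ : AEMeasurable τ P)
    (hind : IndepFun (fun ω t => N t ω) τ P) (d : ℕ → ℝ≥0) {J : ℝ≥0 → ℕ} (hJ : Measurable J)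
    (k : ℕ) :
    P.real {ω | N (d (J (τ ω))) ω = k} = ∫ ω, P.real {ω' | N (d (J (τ ω))) ω' = k} ∂P := by
  have hJτ : AEMeasurable (fun ω => J (τ ω)) P := hJ.comp_aemeasurable hτ
  have hunion : {ω | N (d (J (τ ω))) ω = k} =
      ⋃ j, ({ω | N (d j) ω = k} ∩ {ω | J (τ ω) = j}) := by
    ext ω; simp
  have h1 : P {ω | N (d (J (τ ω))) ω = k} =
      ∫⁻ ω, P {ω' | N (d (J (τ ω))) ω' = k} ∂P := by
    rw [hunion, measure_iUnion₀]
    · have h2 := lintegral_map' (μ := P) (g := fun ω => J (τ ω))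
        (f := fun j => P {ω' | N (d j) ω' = k})
        (measurable_from_nat.aemeasurable) hJτ
      rw [← h2, lintegral_countable']
      refine tsum_congr fun j => ?_
      rw [Measure.map_apply_of_aemeasurable hJτ (measurableSet_singleton j)]
      have hset : MeasurableSet {x : ℝ≥0 → ℕ | x (d j) = k} :=
        (measurable_pi_apply (d j) : Measurable fun x : ℝ≥0 → ℕ => x (d j))
          (measurableSet_singleton k)
      exact hind.measure_inter_preimage_eq_mul {x | x (d j) = k} {x | J x = j} hset
        (hJ (measurableSet_singleton j))
    · intro j j' hjj
      refine Disjoint.aedisjoint (disjoint_left.2 fun ω h1 h2 => hjj ?_)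
      exact h1.2.symm.trans h2.2
    · intro j
      exact ((hN _ (measurableSet_singleton k)).nullMeasurableSet).inter
        (hJτ.nullMeasurable (measurableSet_singleton j))
  have hm : AEMeasurable (fun ω => P {ω' | N (d (J (τ ω))) ω' = k}) P :=
    (measurable_from_nat (f := fun j => P {ω' | N (d j) ω' = k})).comp_aemeasurable hJτ
  simp only [measureReal_def]
  rw [integral_toReal hm (ae_of_all _ fun ω => measure_lt_top _ _), h1]

/-- Right-continuous processes evaluated at an independent random time: approximate the time from
the right by times with countably many values. -/
theorem ProbabilityTheory.IndepFun.measureReal_time_change {Ω : Type*} [MeasurableSpace Ω]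
    {P : Measure Ω} [IsProbabilityMeasure P] {N : ℝ≥0 → Ω → ℕ} (hN : ∀ t, Measurable (N t))
    (hr : ∀ᵐ ω ∂P, ∀ t, ContinuousWithinAt (fun s => N s ω) (Ici t) t) {τ : Ω → ℝ≥0}
    (hτ : AEMeasurable τ P) (hind : IndepFun (fun ω t => N t ω) τ P)
    (hc : ∀ k, Continuous fun s => P.real {ω | N s ω = k}) :
    AEMeasurable (fun ω => N (τ ω) ω) P ∧
    ∀ k, P.real {ω | N (τ ω) ω = k} = ∫ ω, P.real {ω' | N (τ ω) ω' = k} ∂P := by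
  obtain ⟨d, J, hJm, hle, hlim⟩ := NNReal.exists_discrete_approx
  have hlimN : ∀ᵐ ω ∂P, Tendsto (fun m => N (d m (J m (τ ω))) ω) atTop (𝓝 (N (τ ω) ω)) := by
    filter_upwards [hr] with ω hω
    exact (hω (τ ω)).tendsto.comp
      (tendsto_nhdsWithin_iff.2 ⟨hlim _, Eventually.of_forall fun m => hle m _⟩)
  have hmeas : ∀ m, AEMeasurable (fun ω => N (d m (J m (τ ω))) ω) P := fun m => by
    have h1 : Measurable fun p : ℕ × Ω => N (d m p.1) p.2 :=
      measurable_from_prod_countable_right fun j => hN (d m j)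
    exact h1.comp_aemeasurable (((hJm m).comp_aemeasurable hτ).prodMk aemeasurable_id)
  have hmeasτ : AEMeasurable (fun ω => N (τ ω) ω) P :=
    aemeasurable_of_tendsto_metrizable_ae atTop hmeas hlimN
  refine ⟨hmeasτ, fun k => ?_⟩
  have happrox := fun m => hind.measureReal_discrete_time_change hN hτ (d m) (hJm m) k
  have hind1 : ∀ f : Ω → ℕ, AEMeasurable f P → P.real {ω | f ω = k} =
      ∫ ω, ({k} : Set ℕ).indicator (fun _ => (1 : ℝ)) (f ω) ∂P := fun f hf => by
    have hset : NullMeasurableSet {ω | f ω = k} P :=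
      hf.nullMeasurable (measurableSet_singleton k)
    have : (fun ω => ({k} : Set ℕ).indicator (fun _ => (1 : ℝ)) (f ω)) =
        {ω | f ω = k}.indicator (fun _ => 1) := by
      ext ω; simp [indicator]
    rw [this, integral_indicator₀ hset]
    simp
  have hL : Tendsto (fun m => P.real {ω | N (d m (J m (τ ω))) ω = k}) atTop
      (𝓝 (P.real {ω | N (τ ω) ω = k})) := by
    rw [hind1 _ hmeasτ]
    simp_rw [fun m => hind1 _ (hmeas m)]
    refine tendsto_integral_of_dominated_convergence (fun _ => 1) (fun m => ?_)
      (integrable_const _) (fun m => ae_of_all _ fun ω => ?_) ?_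
    · exact ((measurable_from_nat (f := ({k} : Set ℕ).indicator
        (fun _ => (1 : ℝ)))).comp_aemeasurable (hmeas m)).aestronglyMeasurable
    · simp only [indicator]; split_ifs <;> simp
    · filter_upwards [hlimN] with ω hω
      exact ((continuous_of_discreteTopology (f := ({k} : Set ℕ).indicator
        (fun _ => (1 : ℝ)))).tendsto _).comp hω
  have hR : Tendsto (fun m => ∫ ω, P.real {ω' | N (d m (J m (τ ω))) ω' = k} ∂P) atTop
      (𝓝 (∫ ω, P.real {ω' | N (τ ω) ω' = k} ∂P)) := by
    refine tendsto_integral_of_dominated_convergence (fun _ => 1) (fun m => ?_)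
      (integrable_const _) (fun m => ae_of_all _ fun ω => ?_) (ae_of_all _ fun ω => ?_)
    · exact ((measurable_from_nat (f := fun j => P.real {ω' | N (d m j) ω' = k})).comp_aemeasurable
        ((hJm m).comp_aemeasurable hτ)).aestronglyMeasurable
    · rw [Real.norm_of_nonneg measureReal_nonneg]
      exact measureReal_le_one
    · exact ((hc k).tendsto _).comp (hlim _)
  simp_rw [happrox] at hL
  exact tendsto_nhds_unique hL hR

/-! ### State probabilities -/

section
variable {α lam mu : ℝ} {i : ℕ}

/-- A solution consisting of probabilities is the Mittag-Leffler solution. -/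
theorem SolvesQueueSystem.eq_queueSolution (hα₀ : 0 < α) (hα₁ : α ≤ 1) (hlam : 0 < lam)
    (hmu : 0 < mu) {p : ℕ → ℝ → ℝ} (hp : SolvesQueueSystem α lam mu i p)
    (hb : ∀ k t, 0 ≤ t → |p k t| ≤ 1) (k : ℕ) {t : ℝ} (ht : 0 ≤ t) :
    p k t = queueSolution α lam mu i k t := by
  refine hp.unique hα₀ hα₁ hlam hmu (solvesQueueSystem_queueSolution hα₀ hα₁ hlam hmu)
    (fun R => ⟨_, fun k t ht => (abs_sub _ _).trans (add_le_add (hb k t ht.1)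
      (abs_mittagLefflerSeries_one_le hα₀ (by positivity)
        (fun n => abs_queueCoeff_le hlam hmu n k) ht.1 ht.2))⟩) k ht

/-- The forward equations determine the transition probabilities of the classical queue. -/
theorem IsMM1Queue.measureReal_eq {Ω : Type*} [MeasurableSpace Ω] {P : Measure Ω}
    (hlam : 0 < lam) (hmu : 0 < mu)
    {N : ℝ≥0 → Ω → ℕ} (hN : IsMM1Queue lam mu i N P) (k : ℕ) (s : ℝ≥0) :
    P.real {ω | N s ω = k} = queueSolution 1 lam mu i k s := by
  obtain ⟨T, hT, hM⟩ := hN.markov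
  have h := hM 0 (fun _ => s) (fun _ => k) monotone_const
  simp only [Finset.univ_eq_empty, Finset.prod_empty, mul_one, forall_const] at h
  rw [h]
  refine (hT.forward i).eq_queueSolution one_pos le_rfl hlam hmu (fun k t ht => ?_) k s.2
  rw [abs_of_nonneg (hT.nonneg i k t ht)]
  exact le_hasSum (hT.hasSum i t ht) k fun j _ => hT.nonneg i j t ht

/-- Averaging the classical state probabilities over the inverse subordinator turns the exponential
series into the Mittag-Leffler series, moment by moment. -/
theorem IsStableSubordinator.integral_queueSolution {Ω : Type*} [MeasurableSpace Ω] {P : Measure Ω}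
    [IsProbabilityMeasure P] {V : ℝ≥0 → Ω → ℝ} (hα : 0 < α) (hlam : 0 < lam) (hmu : 0 < mu)
    (hV : IsStableSubordinator α V P) (k : ℕ) (t : ℝ≥0) :
    ∫ ω, queueSolution 1 lam mu i k (inverseProcess V t ω) ∂P = queueSolution α lam mu i k t := by
  set a : ℕ → ℝ := fun n => queueCoeff lam mu i n k with ha
  have hE : AEMeasurable (fun ω => (inverseProcess V t ω : ℝ)) P :=
    (hV.aemeasurable_inverseProcess t).coe_nnreal_real
  have hmom : ∀ n : ℕ, Integrable (fun ω => (inverseProcess V t ω : ℝ) ^ n) P ∧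
      ∫ ω, (inverseProcess V t ω : ℝ) ^ n ∂P =
        n.factorial * ((t : ℝ) ^ (α * n) / Real.Gamma (α * n + 1)) := by
    intro n
    have h := hV.lintegral_inverseProcess_pow hα n t
    have hG := Real.Gamma_pos_of_pos (show 0 < α * n + 1 by positivity)
    have h0 : 0 ≤ᵐ[P] fun ω => (inverseProcess V t ω : ℝ) ^ n :=
      ae_of_all _ fun ω => by simp only [Pi.zero_apply]; positivity
    have hm : AEStronglyMeasurable (fun ω => (inverseProcess V t ω : ℝ) ^ n) P :=
      (hE.pow_const n).aestronglyMeasurable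
    refine ⟨(lintegral_ofReal_ne_top_iff_integrable hm h0).1 (h ▸ ENNReal.ofReal_ne_top), ?_⟩
    rw [integral_eq_lintegral_of_nonneg_ae h0 hm, h, ENNReal.toReal_ofReal (by positivity)]
  have hF : ∀ n, Integrable (fun ω => a n / n.factorial * (inverseProcess V t ω : ℝ) ^ n) P :=
    fun n => (hmom n).1.const_mul _
  have hsum : Summable fun n => ∫ ω, ‖a n / n.factorial * (inverseProcess V t ω : ℝ) ^ n‖ ∂P := by
    have := summable_abs_mul_rpow_div_Gamma hα one_pos (C := 2 * (lam + mu)) (by positivity)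
      (fun n => abs_queueCoeff_le (i := i) hlam hmu n k) t.2
    refine this.congr fun n => ?_
    have h1 : ∀ ω, ‖a n / n.factorial * (inverseProcess V t ω : ℝ) ^ n‖ =
        |a n| / n.factorial * (inverseProcess V t ω : ℝ) ^ n := fun ω => by
      rw [norm_mul, norm_div, Real.norm_eq_abs, Real.norm_natCast,
        Real.norm_of_nonneg (by positivity)]
    simp_rw [h1]
    rw [integral_const_mul, (hmom n).2]
    have : (n.factorial : ℝ) ≠ 0 := by positivity
    simp only [ha]
    field_simp
    rfl
  have h := integral_tsum_of_summable_integral_norm hF hsum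
  rw [queueSolution, mittagLefflerSeries_one]
  refine Eq.trans (integral_congr_ae (ae_of_all _ fun ω => ?_)) (h.symm.trans ?_)
  · simp only [queueSolution, mittagLefflerSeries_one]
    refine tsum_congr fun n => ?_
    rw [one_mul, Real.rpow_natCast, Real.Gamma_nat_eq_factorial]
    ring
  · refine tsum_congr fun n => ?_
    rw [integral_const_mul, (hmom n).2]
    have : (n.factorial : ℝ) ≠ 0 := by positivity
    field_simp
    simp only [ha]
    ring

theorem SolvesQueueSystem.congr {p q : ℕ → ℝ → ℝ} (hq : SolvesQueueSystem α lam mu i q)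
    (h : ∀ k, EqOn (p k) (q k) (Ici 0)) : SolvesQueueSystem α lam mu i p := by
  refine ⟨fun k => (hq.continuousOn k).congr (h k), fun k t ht => ?_, fun k => ?_⟩
  · have : queueRHS lam mu p k t = queueRHS lam mu q k t := by
      rw [queueRHS_eq_queueOp, queueRHS_eq_queueOp]
      congr 1
      exact funext fun j => h j (mem_Ici.2 ht.le)
    rw [this]
    exact (hq.equation k t ht).congr ht (h k)
  · rw [h k self_mem_Ici, hq.initial]

end

theorem mainTheorem2 {Ω : Type*} [MeasurableSpace Ω] (P : Measure Ω)
    [IsProbabilityMeasure P] (α lam mu : ℝ) (hα₀ : 0 < α) (hα₁ : α ≤ 1)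
    (hlam : 0 < lam) (hmu : 0 < mu) (i : ℕ)
    (N : ℝ≥0 → Ω → ℕ) (hN : IsMM1Queue lam mu i N P)
    (V : ℝ≥0 → Ω → ℝ) (hV : IsStableSubordinator α V P)
    (hindep : IndepFun (fun ω t => N t ω) (fun ω t => inverseProcess V t ω) P) :
    IsFractionalMM1Queue α lam mu i (fun t ω => N (inverseProcess V t ω) ω) P ∧
    ∀ (Ω' : Type*) [MeasurableSpace Ω'] (P' : Measure Ω') [IsProbabilityMeasure P']
      (Nα : ℝ≥0 → Ω' → ℕ), IsFractionalMM1Queue α lam mu i Nα P' →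
      ∀ t : ℝ≥0, IdentDistrib (Nα t) (fun ω => N (inverseProcess V t ω) ω) P' P := by
  have hc : ∀ k, Continuous fun s => P.real {ω | N s ω = k} := fun k => by
    simp_rw [hN.measureReal_eq hlam hmu]
    exact ((solvesQueueSystem_queueSolution one_pos le_rfl hlam hmu).continuousOn k).comp_continuous
      NNReal.continuous_coe fun s => s.2
  have htc : ∀ t : ℝ≥0, AEMeasurable (fun ω => N (inverseProcess V t ω) ω) P ∧
      ∀ k, P.real {ω | N (inverseProcess V t ω) ω = k} = queueSolution α lam mu i k t := by
    intro t
    have h := IndepFun.measureReal_time_change hN.measurable hN.rightCont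
      (hV.aemeasurable_inverseProcess t)
      (hindep.comp measurable_id (measurable_pi_apply t)) hc
    refine ⟨h.1, fun k => ?_⟩
    rw [h.2, ← hV.integral_queueSolution hα₀ hlam hmu k t]
    simp_rw [hN.measureReal_eq hlam hmu]
  have hsol := solvesQueueSystem_queueSolution (i := i) hα₀ hα₁ hlam hmu
  refine ⟨⟨fun t => (htc t).1, hsol.congr fun k t ht => ?_⟩, ?_⟩
  · rw [(htc _).2, Real.coe_toNNReal _ ht]
  · intro Ω' _ P' _ Nα hNα t
    refine ⟨hNα.aemeasurable t, (htc t).1, Measure.ext_of_singleton fun k => ?_⟩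
    rw [Measure.map_apply_of_aemeasurable (hNα.aemeasurable t) (measurableSet_singleton k),
      Measure.map_apply_of_aemeasurable (htc t).1 (measurableSet_singleton k)]
    refine (measureReal_eq_measureReal_iff).1 ?_
    refine Eq.trans ?_ ((htc t).2 k).symm
    have h := hNα.system.eq_queueSolution hα₀ hα₁ hlam hmu (fun k t _ => ?_) k t.coe_nonneg
    · rwa [Real.toNNReal_coe] at h
    · rw [abs_of_nonneg measureReal_nonneg]
      exact measureReal_le_one
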